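/- Consider elections with a candidate set $C$ of $m\ge 1$ candidates and $n\ge 1$ voters. A profile is $V=(v_1,\dots,v_n)$, where $v_i\in\mathcal L(C)$ is the sincere vote of voter $i$, a linear order over $C$; $(V_{-i},v)$ denotes $V$ with $v_i$ replaced by $v$. Under Plurality $\mathcal R$ the winner is, among the candidates that are ranked first by the largest number of voters, the highest one in a given tie-breaking linear order on $C$. Voter $i$ is a GS-manipulator at $V$ if he prefers $\mathcal R(V_{-i},v)$ to $\mathcal R(V)$ for some vote $v$. A vote $v$ is a level-1 strategy of voter $i$ at $V$ if he prefers $\mathcal R(V_{-i},v)$ to every other candidate of the form $\mathcal R(V_{-i},v')$, $v'\in\mathcal L(C)$. In a GS-game $G$ for $V$ the players are voter 1 and all GS-manipulators at $V$. Player 1 has the strategy set $A_1=\mathcal L(C)$; the strategy set $A_i$ of every other player $i$ consists of his sincere vote and some (possibly none) of his level-1 strategies. Voters who are not players vote sincerely, and each player $i$ compares strategy profiles by the resulting Plurality winners according to $v_i$. A strategy of player 1 weakly dominates another one if, for all strategies of the other players, it yields an outcome that player 1 likes at least as much, and for some strategies of the other players one that he strictly prefers. A strategy of player 1 is a level-2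 strategy if no other strategy of player 1 weakly dominates it, and an improving strategy if it weakly dominates his sincere vote $v_1$. Claim. Let GS-games under Plurality be given by $m$, $n$, the tie-breaking order, the sincere profile $V$, and explicit lists of the strategies in $A_i$ for the players $i\neq 1$. Each of the following problems can be decided in time polynomial in the size of the input: (1) given a GS-game $G$ and a vote $v_1'\in\mathcal L(C)$, is $v_1'$ a level-2 strategy of player 1 in $G$? (2) given a GS-game $G$ and a vote $v_1'\in\mathcal L(C)$, is $v_1'$ an improving strategy of player 1 in $G$? (3) given a GS-game $G$, does player 1 have a level-2 strategy in $G$? (4) given a GS-game $G$, does player 1 have an improving strategy in $G$? -/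

import Mathlib

/-! ## Elections over the candidate set `Fin m` with voter set `Fin n` -/

namespace Voting

/-- A linear order over `m` candidates, given as a ranking: `v p` is the candidate that is
ranked in position `p`, where position `0` is the top one. -/
abbrev Vote (m : ℕ) : Type := Equiv.Perm (Fin m)

/-- `v.symm a` is the position of `a`: the voter with preferences `v` prefers `a` to `b`. -/
def Prefers {m : ℕ} (v : Vote m) (a b : Fin m) : Prop := v.symm a < v.symm b

/-- A preference profile. -/
abbrev Profile (m n : ℕ) : Type := Fin n → Vote m

/-- A resolute voting rule. -/
abbrev VotingRule (m n : ℕ) : Type := Profile m n → Fin m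

/-- The set of the top `k` candidates of a vote. -/
def topK {m : ℕ} (v : Vote m) (k : ℕ) : Finset (Fin m) :=
  Finset.univ.filter fun c => (v.symm c : ℕ) < k

/-- The `k`-approval score. -/
def score {m n : ℕ} (k : ℕ) (V : Profile m n) (c : Fin m) : ℕ :=
  (Finset.univ.filter fun i => c ∈ topK (V i) k).card

/-- The positions in the tie-breaking order of the candidates with the highest score. -/
def winningPositions {m n : ℕ} (tie : Vote m) (k : ℕ) (V : Profile m n) : Finset (Fin m) :=
  Finset.univ.filter fun p => ∀ d : Fin m, score k V d ≤ score k V (tie p)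

theorem winningPositions_nonempty {m n : ℕ} [NeZero m] (tie : Vote m) (k : ℕ)
    (V : Profile m n) : (winningPositions tie k V).Nonempty := by
  obtain ⟨c, -, hc⟩ := Finset.exists_max_image Finset.univ (score k V)
    ⟨(0 : Fin m), Finset.mem_univ _⟩
  exact ⟨tie.symm c, by simpa [winningPositions] using hc⟩

/-- `k`-approval: the winner is the candidate that is ranked highest by the tie-breaking order
`tie` among the candidates with the highest `k`-approval score. -/
def kApproval {m n : ℕ} [NeZero m] (tie : Vote m) (k : ℕ) : VotingRule m n := fun V =>
  tie ((winningPositions tie k V).min' (winningPositions_nonempty tie k V))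

/-- Plurality is `1`-approval. -/
def plurality {m n : ℕ} [NeZero m] (tie : Vote m) : VotingRule m n := kApproval tie 1

/-- Voter `i` is a Gibbard-Satterthwaite manipulator at `V`. Here and below,
`Function.update V i v` is the profile `V` with the vote of `i` replaced by `v`. -/
def IsGSManipulator {m n : ℕ} (R : VotingRule m n) (V : Profile m n) (i : Fin n) : Prop :=
  ∃ v : Vote m, Prefers (V i) (R (Function.update V i v)) (R V)

/-- The candidates that are feasible for voter `i` at `V`. -/
def Feasible {m n : ℕ} (R : VotingRule m n) (V : Profile m n) (i : Fin n) : Set (Fin m) :=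
  {c | ∃ v : Vote m, R (Function.update V i v) = c}

/-- The vote `v` is a level-1 strategy of voter `i` at `V`. -/
def IsLevelOne {m n : ℕ} (R : VotingRule m n) (V : Profile m n) (i : Fin n) (v : Vote m) :
    Prop :=
  ∀ c ∈ Feasible R V i, c ≠ R (Function.update V i v) →
    Prefers (V i) (R (Function.update V i v)) c

/-! ## Normal-form games -/

/-- A normal-form game: `weakPref i s t` says that player `i` weakly prefers the strategy
profile `s` to `t`. -/
structure NormalFormGame where
  Player : Type
  Strategy : Player → Type
  weakPref : Player → (∀ i, Strategy i) → (∀ i, Strategy i) → Prop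

/-- Player `i` strictly prefers the strategy profile `s` to `t`. -/
def NormalFormGame.StrictPref (Γ : NormalFormGame) (i : Γ.Player) (s t : ∀ i, Γ.Strategy i) :
    Prop :=
  Γ.weakPref i s t ∧ ¬ Γ.weakPref i t s

open Classical in
/-- The strategy `a` of player `i` weakly dominates the strategy `b`. The quantifiers range over
full profiles `s`, of which only the strategies of the players other than `i` matter. -/
def NormalFormGame.WeaklyDominates (Γ : NormalFormGame) (i : Γ.Player) (a b : Γ.Strategy i) :
    Prop :=
  (∀ s : ∀ i, Γ.Strategy i, Γ.weakPref i (Function.update s i a) (Function.update s i b)) ∧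
    ∃ s : ∀ i, Γ.Strategy i, Γ.StrictPref i (Function.update s i a) (Function.update s i b)

/-! ## Gibbard-Satterthwaite games. The voter `0 : Fin n` is called voter 1. -/

/-- The players are voter 1 and all Gibbard-Satterthwaite manipulators. -/
def IsPlayer {m n : ℕ} [NeZero n] (R : VotingRule m n) (V : Profile m n) (i : Fin n) : Prop :=
  i = 0 ∨ IsGSManipulator R V i

/-- A GS-game for `V` and `R`, given by the strategy sets of its players: voter 1 may submit any
vote, and every other player has his sincere vote and some of his level-1 strategies. -/
structure GSGame {m n : ℕ} [NeZero n] (R : VotingRule m n) (V : Profile m n) where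
  A : {i : Fin n // IsPlayer R V i} → Set (Vote m)
  A_one : A ⟨0, Or.inl rfl⟩ = Set.univ
  sincere_mem : ∀ i : {i : Fin n // IsPlayer R V i}, V i.1 ∈ A i
  level_one : ∀ i : {i : Fin n // IsPlayer R V i}, i.1 ≠ 0 →
    ∀ v ∈ A i, v = V i.1 ∨ IsLevelOne R V i.1 v

namespace GSGame

variable {m n : ℕ} [NeZero n] {R : VotingRule m n} {V : Profile m n}

open Classical in
/-- The preference profile that results from a strategy profile: voters that are not players
vote sincerely. -/
noncomputable def outcomeProfile (G : GSGame R V)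
    (s : ∀ i : {i : Fin n // IsPlayer R V i}, {v : Vote m // v ∈ G.A i}) : Profile m n :=
  fun i => if h : IsPlayer R V i then (s ⟨i, h⟩).1 else V i

/-- The normal-form game that a GS-game is. -/
abbrev toNormalForm (G : GSGame R V) : NormalFormGame where
  Player := {i : Fin n // IsPlayer R V i}
  Strategy := fun i => {v : Vote m // v ∈ G.A i}
  weakPref := fun i s t =>
    Prefers (V i.1) (R (G.outcomeProfile s)) (R (G.outcomeProfile t)) ∨
      R (G.outcomeProfile s) = R (G.outcomeProfile t)

/-- Voter 1 as a player. -/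
abbrev playerOne (G : GSGame R V) : G.toNormalForm.Player := ⟨0, Or.inl rfl⟩

/-- A vote as a strategy of player 1. -/
abbrev strategyOne (G : GSGame R V) (v : Vote m) : G.toNormalForm.Strategy G.playerOne :=
  ⟨v, (Set.ext_iff.mp G.A_one v).mpr (Set.mem_univ v)⟩

/-- No other strategy of player 1 weakly dominates `v`. -/
def IsLevelTwo (G : GSGame R V) (v : Vote m) : Prop :=
  ∀ u : Vote m, u ≠ v →
    ¬ G.toNormalForm.WeaklyDominates G.playerOne (G.strategyOne u) (G.strategyOne v)

/-- `v` weakly dominates the sincere strategy of player 1. -/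
def IsImproving (G : GSGame R V) (v : Vote m) : Prop :=
  G.toNormalForm.WeaklyDominates G.playerOne (G.strategyOne v) (G.strategyOne (V 0))

end GSGame

/-! ## Problem instances and their encodings -/

/-- A GS-game under Plurality as a problem instance: the tie-breaking order, the sincere profile
and the game, with the strategy sets of the players other than voter 1 listed explicitly, in any
order (voter 1 and the voters that are not players have an empty list). -/
structure Instance where
  m : ℕ
  n : ℕ
  [hm : NeZero m]
  [hn : NeZero n]
  tie : Vote m
  V : Profile m n
  game : GSGame (plurality tie) V
  lists : Fin n → List (Vote m)
  mem_lists : ∀ (i : Fin n) (v : Vote m),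
    v ∈ lists i ↔ i ≠ 0 ∧ ∃ h : IsPlayer (plurality tie) V i, v ∈ game.A ⟨i, h⟩

attribute [instance] Instance.hm Instance.hn

/-- A vote is written down as the list of its candidates from top to bottom. -/
def encodeVote {m : ℕ} (v : Vote m) : List ℕ := List.ofFn fun p => (v p : ℕ)

/-- A list of votes is written down as its length, followed by the votes. -/
def encodeVotes {m : ℕ} (l : List (Vote m)) : List ℕ := l.length :: l.flatMap encodeVote

/-- An instance is written down as the number of candidates, the number of voters, the
tie-breaking order, the sincere votes, and the strategy lists of voters `0, …, n - 1`. -/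
def Instance.encode (I : Instance) : List ℕ :=
  [I.m, I.n] ++ encodeVote I.tie ++ (List.ofFn I.V).flatMap encodeVote ++
    (List.ofFn I.lists).flatMap encodeVotes

/-- An instance together with a strategy of player 1. -/
structure VoteInstance extends Instance where
  vote : Vote m

/-- The instance, followed by the strategy of player 1. -/
def VoteInstance.encode (J : VoteInstance) : List ℕ :=
  J.toInstance.encode ++ encodeVote J.vote

end Voting

/-! ## Random access machines and polynomial time -/

namespace RAM

/-- The memory: scalar registers, and arrays that are addressed indirectly. -/
structure State where
  var : ℕ → ℕ
  arr : ℕ → ℕ → ℕ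

/-- Expressions: constants, registers, array cells, addition and truncated subtraction. There is
no multiplication, so that counting every operation as one step is realistic. -/
inductive Expr : Type
  | const (k : ℕ)
  | var (x : ℕ)
  | get (a : ℕ) (i : Expr)
  | add (e f : Expr)
  | sub (e f : Expr)

/-- The value of an expression. -/
def Expr.eval (s : State) : Expr → ℕ
  | .const k => k
  | .var x => s.var x
  | .get a i => s.arr a (i.eval s)
  | .add e f => e.eval s + f.eval s
  | .sub e f => e.eval s - f.eval s

/-- The number of operations in an expression. -/
def Expr.cost : Expr → ℕ
  | .const _ => 1
  | .var _ => 1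
  | .get _ i => i.cost + 1
  | .add e f => e.cost + f.cost + 1
  | .sub e f => e.cost + f.cost + 1

/-- Structured programs. Tests succeed on nonzero values. -/
inductive Cmd : Type
  | skip
  | assign (x : ℕ) (e : Expr)
  | store (a : ℕ) (i e : Expr)
  | seq (c d : Cmd)
  | ite (e : Expr) (c d : Cmd)
  | loop (e : Expr) (c : Cmd)

/-- Overwrite a register. -/
def State.setVar (s : State) (x k : ℕ) : State :=
  { s with var := Function.update s.var x k }

/-- Overwrite an array cell. -/
def State.setArr (s : State) (a i k : ℕ) : State :=
  { s with arr := Function.update s.arr a (Function.update (s.arr a) i k) }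

/-- `Exec c s s' t`: started in state `s`, the program `c` halts in state `s'` after `t` steps. -/
inductive Exec : Cmd → State → State → ℕ → Prop
  | skip (s : State) : Exec .skip s s 1
  | assign (s : State) (x : ℕ) (e : Expr) :
      Exec (.assign x e) s (s.setVar x (e.eval s)) (e.cost + 1)
  | store (s : State) (a : ℕ) (i e : Expr) :
      Exec (.store a i e) s (s.setArr a (i.eval s) (e.eval s)) (i.cost + e.cost + 1)
  | seq {c d : Cmd} {s s' s'' : State} {t t' : ℕ} :
      Exec c s s' t → Exec d s' s'' t' → Exec (.seq c d) s s'' (t + t')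
  | ite_true {e : Expr} {c d : Cmd} {s s' : State} {t : ℕ} :
      e.eval s ≠ 0 → Exec c s s' t → Exec (.ite e c d) s s' (e.cost + 1 + t)
  | ite_false {e : Expr} {c d : Cmd} {s s' : State} {t : ℕ} :
      e.eval s = 0 → Exec d s s' t → Exec (.ite e c d) s s' (e.cost + 1 + t)
  | loop_true {e : Expr} {c : Cmd} {s s' s'' : State} {t t' : ℕ} :
      e.eval s ≠ 0 → Exec c s s' t → Exec (.loop e c) s' s'' t' →
        Exec (.loop e c) s s'' (e.cost + 1 + t + t')
  | loop_false {e : Expr} {c : Cmd} {s : State} :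
      e.eval s = 0 → Exec (.loop e c) s s (e.cost + 1)

/-- The initial state on input `x`: array `0` holds the input, one number per cell, register `0`
holds its length, and all other cells are `0`. -/
def State.init (x : List ℕ) : State where
  var := fun r => if r = 0 then x.length else 0
  arr := fun a i => if a = 0 then x.getD i 0 else 0

/-- The size of an input in bits: every number is written in binary, with a separator. -/
def bitSize (x : List ℕ) : ℕ := (x.map fun k => Nat.size k + 1).sum

open Classical in
/-- A property `P` of objects that are given in the encoding `enc` is decidable in polynomial
time: one program halts on the encoding of every object `a` within a number of steps that is
polynomial in the size of the encoding, with `1` in register `0` if `P a` holds and `0` if not. -/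
def PolyTimeDecidable {α : Type} (enc : α → List ℕ) (P : α → Prop) : Prop :=
  ∃ (c : Cmd) (p : Polynomial ℕ), ∀ a : α, ∃ (s : State) (t : ℕ),
    Exec c (State.init (enc a)) s t ∧ t ≤ p.eval (bitSize (enc a)) ∧
      s.var 0 = if P a then 1 else 0

end RAM

namespace RAM

/-! ## Programs with bounded loops -/

/-! Plurality only sees first places, so a strategy of voter 1 counts only through its top
candidate, and the strategy set of another voter only through the set of tops it contains. Since the
strategies of the others are chosen independently, "`u` weakly dominates `v`" becomes: some choice
of tops for the others makes voter 1 better off with `u` than with `v`, and no choice does the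
reverse (`GSGame.weaklyDominates_iff`, `Instance.better_iff`). It remains to decide, for candidates
`a` and `b`, whether some choice of tops makes voting for `a` strictly better than voting for `b`.

For this, guess the winner `x` under `a`, the winner `y` under `b`, and the numbers `U` and `W` of
votes that `x` and `y` get from the others. There are at most `m ^ 2 * n ^ 2` guesses. Once they are
fixed, "`x` wins under `a` and `y` wins under `b`" is an upper bound on the votes of each candidate
separately. Give every candidate as many slots as its bound allows: `x` then has exactly `U` slots
and `y` exactly `W`. A suitable choice of tops is a matching of the other voters into slots they
accept that fills all slots of `x` and `y`. Dummies who refuse the slots of `x` and `y` take up what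
is left, so this is an ordinary bipartite matching problem (`Auction.hasMatching_iff`,
`GameData.feasible_iff`).

Matchings are found by an auction with unit price increments. If everybody can be matched, Hall's
condition keeps all prices at most `S + 1`, where `S` is the number of slots
(`Inv.price_le_of_hasMatching`). Every bid raises the sum of prices by one, so the auction is over
after more than `S * (S + 1)` steps or there is no matching (`Progress.done_iff`).

Problems (1), (2) and (4) compare one top candidate with one or all others. Problem (3) is trivial:
weak dominance is a strict order on a finite set, so undominated strategies always exist
(`GSGame.exists_isLevelTwo`).

For the running time, programs are written in a language whose loops make at most as many rounds as
the length of the input, kept in register `1`. Any fixed program of this kind is polynomial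
(`exists_exec_compile`), so only its denotation `den` has to be analysed. -/

instance : Add Expr := ⟨Expr.add⟩
instance : Sub Expr := ⟨Expr.sub⟩

theorem eval_add (s : State) (e f : Expr) : (e + f).eval s = e.eval s + f.eval s := rfl
theorem eval_sub (s : State) (e f : Expr) : (e - f).eval s = e.eval s - f.eval s := rfl
theorem eval_const (s : State) (k : ℕ) : (Expr.const k).eval s = k := rfl
theorem eval_var (s : State) (x : ℕ) : (Expr.var x).eval s = s.var x := rfl
theorem eval_get (s : State) (a : ℕ) (i : Expr) : (Expr.get a i).eval s = s.arr a (i.eval s) :=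
  rfl

/-- The truth value of `e = f`. -/
def Expr.eqE (e f : Expr) : Expr := .const 1 - ((e - f) + (f - e))

/-- The truth value of `e < f`. -/
def Expr.ltE (e f : Expr) : Expr := .const 1 - (.const 1 - (f - e))

theorem eval_eqE (s : State) (e f : Expr) :
    (e.eqE f).eval s = if e.eval s = f.eval s then 1 else 0 := by
  simp only [Expr.eqE, eval_add, eval_sub, eval_const]
  split_ifs <;> omega

theorem eval_ltE (s : State) (e f : Expr) :
    (e.ltE f).eval s = if e.eval s < f.eval s then 1 else 0 := by
  simp only [Expr.ltE, eval_sub, eval_const]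
  split_ifs <;> omega

/-- Programs all of whose loops are bounded: `upto x h e c` runs `c` for the values
`0, 1, …` of register `x` below `e`, but at most as often as register `1` says; register `h`
keeps the bound. -/
inductive Prog : Type
  | skip
  | assign (x : ℕ) (e : Expr)
  | store (a : ℕ) (i e : Expr)
  | seq (c d : Prog)
  | ite (e : Expr) (c d : Prog)
  | upto (x h : ℕ) (e : Expr) (c : Prog)

namespace Prog

/-- The state after `k` rounds of a loop with counter `x` and body `f`. -/
def rounds (f : State → State) (x : ℕ) (s : State) : ℕ → State
  | 0 => s.setVar x 0
  | k + 1 => (f (rounds f x s k)).setVar x (k + 1)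

/-- The state in which a program halts. -/
def den : Prog → State → State
  | skip, s => s
  | assign x e, s => s.setVar x (e.eval s)
  | store a i e, s => s.setArr a (i.eval s) (e.eval s)
  | seq c d, s => den d (den c s)
  | ite e c d, s => if e.eval s = 0 then den d s else den c s
  | upto x h e c, s =>
      rounds (den c) x (s.setVar h (min (e.eval s) (s.var 1))) (min (e.eval s) (s.var 1))

/-- The registers that a program may overwrite. -/
def writes : Prog → List ℕ
  | skip => []
  | assign x _ => [x]
  | store _ _ _ => []
  | seq c d => writes c ++ writes d
  | ite _ c d => writes c ++ writes d
  | upto x h _ c => x :: h :: writes c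

/-- The arrays that a program may overwrite. -/
def stores : Prog → List ℕ
  | skip => []
  | assign _ _ => []
  | store a _ _ => [a]
  | seq c d => stores c ++ stores d
  | ite _ c d => stores c ++ stores d
  | upto _ _ _ c => stores c

/-- Loops do not overwrite the registers that control them. -/
def wf : Prog → Bool
  | skip => true
  | assign _ _ => true
  | store _ _ _ => true
  | seq c d => wf c && wf d
  | ite _ c d => wf c && wf d
  | upto x h _ c => wf c && decide (x ≠ h ∧ x ≠ 1 ∧ h ≠ 1 ∧
      x ∉ writes c ∧ h ∉ writes c ∧ 1 ∉ writes c)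

/-- The translation into a RAM program. -/
def compile : Prog → Cmd
  | skip => .skip
  | assign x e => .assign x e
  | store a i e => .store a i e
  | seq c d => .seq (compile c) (compile d)
  | ite e c d => .ite e (compile c) (compile d)
  | upto x h e c =>
      .seq (.assign h (e - (e - .var 1))) (.seq (.assign x (.const 0))
        (.loop (.var h - .var x) (.seq (compile c) (.assign x (.var x + .const 1)))))

theorem den_var (p : Prog) (s : State) {r : ℕ} (hr : r ∉ p.writes) :
    (p.den s).var r = s.var r := by
  induction p generalizing s with
  | skip => rfl
  | assign x e =>
    simp only [writes, List.mem_singleton] at hr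
    simp [den, State.setVar, hr]
  | store a i e => rfl
  | seq c d hc hd =>
    simp only [writes, List.mem_append, not_or] at hr
    rw [den, hd _ hr.2, hc _ hr.1]
  | ite e c d hc hd =>
    simp only [writes, List.mem_append, not_or] at hr
    rw [den]
    split_ifs
    · exact hd _ hr.2
    · exact hc _ hr.1
  | upto x h e c hc =>
    simp only [writes, List.mem_cons, not_or] at hr
    rw [den]
    generalize min (e.eval s) (s.var 1) = N
    have key : ∀ k, (rounds c.den x (s.setVar h N) k).var r = s.var r := by
      intro k
      induction k with
      | zero => simp [rounds, State.setVar, hr]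
      | succ k ih =>
        simp only [rounds, State.setVar, Function.update_of_ne hr.1] at ih ⊢
        rw [hc _ hr.2.2, ih]
    exact key N

theorem den_arr (p : Prog) (s : State) {a : ℕ} (ha : a ∉ p.stores) :
    (p.den s).arr a = s.arr a := by
  induction p generalizing s with
  | skip => rfl
  | assign x e => rfl
  | store b i e =>
    simp only [stores, List.mem_singleton] at ha
    simp [den, State.setArr, ha]
  | seq c d hc hd =>
    simp only [stores, List.mem_append, not_or] at ha
    rw [den, hd _ ha.2, hc _ ha.1]
  | ite e c d hc hd =>
    simp only [stores, List.mem_append, not_or] at ha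
    rw [den]
    split_ifs
    · exact hd _ ha.2
    · exact hc _ ha.1
  | upto x h e c hc =>
    simp only [stores] at ha
    rw [den]
    generalize min (e.eval s) (s.var 1) = N
    have key : ∀ k, (rounds c.den x (s.setVar h N) k).arr a = s.arr a := by
      intro k
      induction k with
      | zero => rfl
      | succ k ih =>
        simp only [rounds, State.setVar] at ih ⊢
        rw [hc _ ha, ih]
    exact key N

/-- The invariant rule for bounded loops. -/
theorem upto_induction {x h : ℕ} {e : Expr} {c : Prog} {s : State} {N : ℕ}
    (hN : e.eval s = N) (hL : N ≤ s.var 1) (I : ℕ → State → Prop)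
    (h0 : I 0 ((s.setVar h N).setVar x 0))
    (hs : ∀ k r, k < N → r.var x = k → I k r → I (k + 1) ((c.den r).setVar x (k + 1))) :
    I N ((upto x h e c).den s) := by
  -- As `N` does not exceed register `1`, the cap has no effect and exactly `N` rounds are made.
  rw [den, hN, min_eq_left hL]
  have key : ∀ k ≤ N, (rounds c.den x (s.setVar h N) k).var x = k ∧
      I k (rounds c.den x (s.setVar h N) k) := by
    intro k
    induction k with
    | zero => exact fun _ => ⟨by simp [rounds, State.setVar], h0⟩
    | succ k ih =>
      intro hk
      obtain ⟨h1, h2⟩ := ih (by omega)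
      exact ⟨by simp [rounds, State.setVar], hs k _ (by omega) h1 h2⟩
  exact (key N le_rfl).2

/-- A program that does not overwrite register `1` runs in time polynomial in its value. -/
theorem exists_exec_compile (p : Prog) (hp : p.wf = true) (h1 : 1 ∉ p.writes) :
    ∃ C k : ℕ, ∀ (s : State) (B : ℕ), s.var 1 ≤ B →
      ∃ t, Exec p.compile s (p.den s) t ∧ t ≤ C * (B + 1) ^ k := by
  induction p with
  | skip => exact ⟨1, 0, fun s B _ => ⟨1, .skip s, by simp⟩⟩
  | assign x e => exact ⟨e.cost + 1, 0, fun s B _ => ⟨_, .assign s x e, by simp⟩⟩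
  | store a i e => exact ⟨i.cost + e.cost + 1, 0, fun s B _ => ⟨_, .store s a i e, by simp⟩⟩
  | seq c d hc hd =>
    simp only [wf, Bool.and_eq_true] at hp
    simp only [writes, List.mem_append, not_or] at h1
    obtain ⟨C, k, hC⟩ := hc hp.1 h1.1
    obtain ⟨D, l, hD⟩ := hd hp.2 h1.2
    -- Both powers of `B + 1` are at most the one with exponent `k + l`, so the coefficients can be
    -- added.
    refine ⟨C + D, k + l, fun s B hB => ?_⟩
    have hkl : (B + 1) ^ k ≤ (B + 1) ^ (k + l) := Nat.pow_le_pow_right (by omega) (by omega)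
    have hlk : (B + 1) ^ l ≤ (B + 1) ^ (k + l) := Nat.pow_le_pow_right (by omega) (by omega)
    obtain ⟨t, ht, hle⟩ := hC s B hB
    obtain ⟨t', ht', hle'⟩ := hD (c.den s) B (by rwa [den_var c s h1.1])
    exact ⟨_, .seq ht ht', by nlinarith⟩
  | ite e c d hc hd =>
    simp only [wf, Bool.and_eq_true] at hp
    simp only [writes, List.mem_append, not_or] at h1
    obtain ⟨C, k, hC⟩ := hc hp.1 h1.1
    obtain ⟨D, l, hD⟩ := hd hp.2 h1.2
    refine ⟨e.cost + 1 + C + D, k + l, fun s B hB => ?_⟩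
    have hkl : (B + 1) ^ k ≤ (B + 1) ^ (k + l) := Nat.pow_le_pow_right (by omega) (by omega)
    have hlk : (B + 1) ^ l ≤ (B + 1) ^ (k + l) := Nat.pow_le_pow_right (by omega) (by omega)
    have h0 : 1 ≤ (B + 1) ^ (k + l) := Nat.one_le_pow _ _ (by omega)
    rw [den]
    split_ifs with he
    · obtain ⟨t, ht, hle⟩ := hD s B hB
      exact ⟨_, .ite_false he ht, by nlinarith⟩
    · obtain ⟨t, ht, hle⟩ := hC s B hB
      exact ⟨_, .ite_true he ht, by nlinarith⟩
  | upto x h e c hc =>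
    simp only [wf, Bool.and_eq_true, decide_eq_true_eq] at hp
    obtain ⟨hp, hxh, -, hh1, hxc, hhc, h1c⟩ := hp
    obtain ⟨C, k, hC⟩ := hc hp h1c
    -- The bound `e` is evaluated twice, since the minimum with register `1` is computed as `e - (e
    -- - .var 1)`. A round costs the body plus `8` for test and increment, and at most `B` rounds
    -- raise the exponent by one. The rest is slack.
    refine ⟨2 * e.cost + C + 20, k + 1, fun s B hB => ?_⟩
    rw [den]
    generalize hN : min (e.eval s) (s.var 1) = N
    have hNB : N ≤ B := hN ▸ (min_le_right _ _).trans hB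
    set f := rounds c.den x (s.setVar h N) with hf
    have hh : ∀ k, (f k).var h = N := by
      intro k
      induction k with
      | zero => simp [hf, rounds, State.setVar, hxh.symm]
      | succ k ih =>
        simp only [hf, rounds, State.setVar, Function.update_of_ne hxh.symm] at ih ⊢
        rw [den_var c _ hhc, ih]
    have hL : ∀ k, (f k).var 1 = s.var 1 := by
      intro k
      simp only [writes, List.mem_cons, not_or] at h1
      induction k with
      | zero => simp [hf, rounds, State.setVar, h1]
      | succ k ih =>
        simp only [hf, rounds, State.setVar, Function.update_of_ne h1.1] at ih ⊢
        rw [den_var c _ h1c, ih]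
    have hx : ∀ k, (f k).var x = k := by
      intro k
      cases k <;> simp [hf, rounds, State.setVar]
    -- Induction on the number `j` of rounds still to come, because `Exec.loop_true` peels off the
    -- first of them.
    have loop : ∀ j ≤ N, ∃ t, Exec (.loop (.var h - .var x)
        (.seq c.compile (.assign x (.var x + .const 1)))) (f (N - j)) (f N) t ∧
        t ≤ j * (C * (B + 1) ^ k + 8) + 4 := by
      intro j
      induction j with
      | zero =>
        refine fun _ => ⟨_, .loop_false ?_, ?_⟩
        · simp [eval_sub, eval_var, hh, hx]
        · change 1 + 1 + 1 + 1 ≤ _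
          omega
      | succ j ih =>
        intro hj
        obtain ⟨t, ht, hle⟩ := ih (by omega)
        obtain ⟨u, hu, hule⟩ := hC (f (N - (j + 1))) B (by rw [hL]; exact hB)
        have hstep : (c.den (f (N - (j + 1)))).setVar x
            ((Expr.var x + Expr.const 1).eval (c.den (f (N - (j + 1))))) = f (N - j) := by
          rw [eval_add, eval_var, eval_const, den_var c _ hxc, hx,
            show N - j = N - (j + 1) + 1 by omega]
          rfl
        have h2 := Exec.assign (c.den (f (N - (j + 1)))) x (.var x + .const 1)
        rw [hstep] at h2
        refine ⟨_, .loop_true ?_ (.seq hu h2) ht, ?_⟩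
        · rw [eval_sub, eval_var, eval_var, hh, hx]
          omega
        · change 1 + 1 + 1 + 1 + (u + (1 + 1 + 1 + 1)) + t ≤ _
          rw [Nat.succ_mul]
          omega
    obtain ⟨t, ht, hle⟩ := loop N le_rfl
    have e1 := Exec.assign s h (e - (e - .var 1))
    have hmin : (e - (e - .var 1)).eval s = N := by
      rw [eval_sub, eval_sub, eval_var]
      omega
    rw [hmin] at e1
    have e2 := Exec.assign (s.setVar h N) x (.const 0)
    rw [Nat.sub_self] at ht
    refine ⟨_, .seq e1 (.seq e2 ht), ?_⟩
    change e.cost + (e.cost + 1 + 1) + 1 + 1 + (1 + 1 + t) ≤ _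
    have h0 : 1 ≤ (B + 1) ^ k := Nat.one_le_pow _ _ (by omega)
    have h3 : N * (C * (B + 1) ^ k + 8) ≤ B * (C * (B + 1) ^ k + 8) :=
      Nat.mul_le_mul_right _ hNB
    rw [pow_succ]
    generalize (B + 1) ^ k = P at *
    have h4 : e.cost ≤ e.cost * P := Nat.le_mul_of_pos_right _ h0
    have h5 : e.cost * P ≤ e.cost * (P * (B + 1)) := by gcongr; nlinarith
    have h6 : B ≤ P * B := Nat.le_mul_of_pos_left _ h0
    nlinarith

end Prog
end RAM

/-! ## Matching slots to agents by an auction -/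

namespace Auction

/-- The agents `1, …, A - 1` can be matched into the slots `0, …, S - 1`. -/
def HasMatching (adj : ℕ → ℕ → Prop) (S A : ℕ) : Prop :=
  ∃ μ : ℕ → ℕ, (∀ i, 1 ≤ i → i < A → μ i < S ∧ adj i (μ i)) ∧
    ∀ i j, 1 ≤ i → i < A → 1 ≤ j → j < A → μ i = μ j → i = j

/-- The invariant of the auction: the agents below `next` own one slot each, except for the
agent `cur` who is about to bid (`0` stands for nobody), and no agent pays more than one unit
above the cheapest slot that is acceptable to him. -/
structure Inv (adj : ℕ → ℕ → Prop) (S A cur next : ℕ) (price owner : ℕ → ℕ) : Prop where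
  next_pos : 1 ≤ next
  next_le : next ≤ A
  cur_lt : cur < next
  owner_lt : ∀ j < S, owner j < next
  owner_eq_zero : ∀ j < S, (owner j = 0 ↔ price j = 0)
  adj_owner : ∀ j < S, owner j ≠ 0 → adj (owner j) j
  owner_inj : ∀ j < S, ∀ k < S, owner j = owner k → owner j ≠ 0 → j = k
  owner_ne_cur : ∀ j < S, owner j ≠ 0 → owner j ≠ cur
  exists_owner : ∀ i, 1 ≤ i → i < next → i = cur ∨ ∃ j < S, owner j = i
  price_le : ∀ j < S, owner j ≠ 0 → ∀ k < S, adj (owner j) k → price j ≤ price k + 1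

variable {adj : ℕ → ℕ → Prop} {S A cur next : ℕ} {price owner : ℕ → ℕ}

theorem inv_init (hA : 1 ≤ A) (hp : ∀ j < S, price j = 0) (ho : ∀ j < S, owner j = 0) :
    Inv adj S A 0 1 price owner where
  next_pos := le_rfl
  next_le := hA
  cur_lt := one_pos
  owner_lt j hj := by simp [ho j hj]
  owner_eq_zero j hj := by simp [ho j hj, hp j hj]
  adj_owner j hj h := (h (ho j hj)).elim
  owner_inj j hj _ _ _ h := (h (ho j hj)).elim
  owner_ne_cur j hj h := (h (ho j hj)).elim
  exists_owner i h h' := by omega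
  price_le j hj h := (h (ho j hj)).elim

theorem Inv.take (h : Inv adj S A 0 next price owner) (hn : next < A) :
    Inv adj S A next (next + 1) price owner where
  next_pos := by omega
  next_le := hn
  cur_lt := by omega
  owner_lt j hj := (h.owner_lt j hj).trans (by omega)
  owner_eq_zero := h.owner_eq_zero
  adj_owner := h.adj_owner
  owner_inj := h.owner_inj
  owner_ne_cur j hj _ := (h.owner_lt j hj).ne
  exists_owner i h1 h2 := by
    by_cases hi : i = next
    · exact .inl hi
    · rcases h.exists_owner i h1 (by omega) with h3 | h3
      · omega
      · exact .inr h3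
  price_le := h.price_le

/-- The bidder takes a cheapest acceptable slot and raises its price by one, so he pays at most one
unit too much. Prices never fall, so this stays true of the other owners. The displaced owner bids
next; for a free slot this is `0`, nobody. -/
theorem Inv.bid (h : Inv adj S A cur next price owner) (hc : cur ≠ 0) {b : ℕ} (hb : b < S)
    (hadj : adj cur b) (hmin : ∀ j < S, adj cur j → price b ≤ price j) :
    Inv adj S A (owner b) next (Function.update price b (price b + 1))
      (Function.update owner b cur) where
  next_pos := h.next_pos
  next_le := h.next_le
  cur_lt := h.owner_lt b hb
  owner_lt j hj := by
    rcases eq_or_ne j b with rfl | hjb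
    · simpa using h.cur_lt
    · simpa [hjb] using h.owner_lt j hj
  owner_eq_zero j hj := by
    rcases eq_or_ne j b with rfl | hjb
    · simpa using hc
    · simpa [hjb] using h.owner_eq_zero j hj
  adj_owner j hj := by
    rcases eq_or_ne j b with rfl | hjb
    · simpa using fun _ => hadj
    · simpa [hjb] using h.adj_owner j hj
  owner_inj j hj k hk := by
    rcases eq_or_ne j b with rfl | hjb <;> rcases eq_or_ne k j with rfl | hkj
    · simp
    · intro h1 h2
      simp only [Function.update_self, Function.update_of_ne hkj] at h1
      exact (h.owner_ne_cur k hk (by omega) h1.symm).elim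
    · simp
    · rcases eq_or_ne k b with rfl | hkb
      · intro h1 h2
        simp only [Function.update_self, Function.update_of_ne hjb] at h1 h2
        exact (h.owner_ne_cur j hj h2 h1).elim
      · simpa [hjb, hkb] using h.owner_inj j hj k hk
  owner_ne_cur j hj := by
    rcases eq_or_ne j b with rfl | hjb
    · simp only [Function.update_self]
      intro _ h2
      exact h.owner_ne_cur j hj (by omega) h2.symm
    · simp only [Function.update_of_ne hjb]
      exact fun h1 h2 => hjb (h.owner_inj j hj b hb h2 h1)
  exists_owner i h1 h2 := by
    by_cases hi : i = owner b
    · exact .inl hi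
    · right
      rcases h.exists_owner i h1 h2 with rfl | ⟨j, hj, rfl⟩
      · exact ⟨b, hb, by simp⟩
      · have hjb : j ≠ b := fun e => hi (e ▸ rfl)
        exact ⟨j, hj, by simp [hjb]⟩
  price_le j hj := by
    have key : ∀ k, price k ≤ Function.update price b (price b + 1) k := by
      intro k
      rcases eq_or_ne k b with rfl | hk <;> simp [*]
    rcases eq_or_ne j b with rfl | hjb
    · simp only [Function.update_self]
      intro _ k hk hak
      have := hmin k hk hak
      have := key k
      omega
    · simp only [Function.update_of_ne hjb]
      intro h1 k hk hak
      have := h.price_le j hj h1 k hk hak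
      have := key k
      omega

/-- If the agents can be matched, then prices stay low. -/
theorem Inv.price_le_of_hasMatching (h : Inv adj S A cur next price owner)
    (hM : HasMatching adj S A) (hc : cur ≠ 0) {b : ℕ} (hb : b < S)
    (hmin : ∀ j < S, adj cur j → price b ≤ price j) : price b ≤ S := by
  obtain ⟨μ, hμ, hinj⟩ := hM
  by_contra! hlt
  -- `D k` is the set of slots of price at least `k`. If `price b` exceeded `S`, then `D (S + 1)`
  -- would be nonempty, and a chain of `S + 1` nonempty subsets of `S` slots cannot decrease
  -- strictly throughout: some price level `k` between `1` and `S` is skipped.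
  let D : ℕ → Finset ℕ := fun k => (Finset.range S).filter fun j => k ≤ price j
  have hD : ∀ {k j}, j ∈ D k ↔ j < S ∧ k ≤ price j := by simp [D]
  -- the strict decrease of the level sets has to stop
  obtain ⟨k, hk1, hkS, hk⟩ : ∃ k, 1 ≤ k ∧ k ≤ S ∧ D k ⊆ D (k + 1) := by
    by_contra! hcon
    have hcard : ∀ k ≤ S, (D (k + 1)).card + k ≤ S := by
      intro k
      induction k with
      | zero =>
        intro _
        have := Finset.card_filter_le (Finset.range S) fun j => 0 + 1 ≤ price j
        simpa [D] using this
      | succ k ih =>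
        intro hk
        have h1 := ih (by omega)
        have h2 : (D (k + 1 + 1)).card < (D (k + 1)).card := by
          refine Finset.card_lt_card ⟨fun j hj => ?_, hcon (k + 1) (by omega) hk⟩
          rw [hD] at hj ⊢
          omega
        omega
    have h1 := hcard S le_rfl
    have h2 : b ∈ D (S + 1) := hD.2 ⟨hb, hlt⟩
    have := Finset.card_pos.2 ⟨b, h2⟩
    omega
  have hown : ∀ j ∈ D (k + 1), owner j ≠ 0 := by
    intro j hj h0
    rw [hD] at hj
    have := (h.owner_eq_zero j hj.1).1 h0
    omega
  -- Hall's condition fails for the owners of the slots above the gap together with the bidder: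
  -- there is one more of them than slots in `D (k + 1)`.
  let E : Finset ℕ := insert cur ((D (k + 1)).image owner)
  have hE : E.card = (D (k + 1)).card + 1 := by
    rw [Finset.card_insert_of_notMem, Finset.card_image_of_injOn]
    · intro i hi j hj hij
      exact h.owner_inj i (hD.1 hi).1 j (hD.1 hj).1 hij (hown i hi)
    · intro hmem
      obtain ⟨j, hj, hjc⟩ := Finset.mem_image.1 hmem
      exact h.owner_ne_cur j (hD.1 hj).1 (hown j hj) hjc
  have hrange : ∀ i ∈ E, 1 ≤ i ∧ i < A := by
    intro i hi
    have h1 := h.next_le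
    rcases Finset.mem_insert.1 hi with rfl | hi
    · have := h.cur_lt
      omega
    · obtain ⟨j, hj, rfl⟩ := Finset.mem_image.1 hi
      have := h.owner_lt j (hD.1 hj).1
      have := hown j hj
      omega
  -- An owner pays at least `k + 1`, hence accepts no slot below price `k`; the bidder accepts none
  -- below `price b`. As no price equals `k`, all these slots lie in `D (k + 1)`.
  have hmap : ∀ i ∈ E, μ i ∈ D (k + 1) := by
    intro i hi
    obtain ⟨h1, h2⟩ := hμ i (hrange i hi).1 (hrange i hi).2
    rcases Finset.mem_insert.1 hi with rfl | hi
    · have := hmin _ h1 h2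
      exact hD.2 ⟨h1, by omega⟩
    · obtain ⟨j, hj, rfl⟩ := Finset.mem_image.1 hi
      have := h.price_le j (hD.1 hj).1 (hown j hj) _ h1 h2
      have := (hD.1 hj).2
      exact hk (hD.2 ⟨h1, by omega⟩)
  have hle : E.card ≤ (D (k + 1)).card := by
    refine Finset.card_le_card_of_injOn μ hmap fun i hi j hj hij => ?_
    exact hinj i j (hrange i hi).1 (hrange i hi).2 (hrange j hj).1 (hrange j hj).2 hij
  omega

theorem Inv.hasMatching (h : Inv adj S A 0 A price owner) : HasMatching adj S A := by
  have : ∀ i, ∃ j, 1 ≤ i → i < A → j < S ∧ owner j = i := by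
    intro i
    by_cases hi : 1 ≤ i ∧ i < A
    · rcases h.exists_owner i hi.1 hi.2 with h0 | ⟨j, hj, hji⟩
      · omega
      · exact ⟨j, fun _ _ => ⟨hj, hji⟩⟩
    · exact ⟨0, by omega⟩
  choose μ hμ using this
  refine ⟨μ, fun i h1 h2 => ⟨(hμ i h1 h2).1, ?_⟩, fun i j h1 h2 h3 h4 hij => ?_⟩
  · have := h.adj_owner _ (hμ i h1 h2).1 (by rw [(hμ i h1 h2).2]; omega)
    rwa [(hμ i h1 h2).2] at this
  · rw [← (hμ i h1 h2).2, hij, (hμ j h3 h4).2]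

/-- The progress of the auction after `r` steps. -/
structure Progress (adj : ℕ → ℕ → Prop) (S A cur next : ℕ) (price owner : ℕ → ℕ) (r : ℕ) :
    Prop extends Inv adj S A cur next price owner where
  price_bound : HasMatching adj S A → ∀ j < S, price j ≤ S + 1
  progress : HasMatching adj S A → (cur = 0 ∧ next = A) ∨ r ≤ ∑ j ∈ Finset.range S, price j

/-- A bid adds exactly one to the sum of the prices, which therefore keeps up with the number of
steps. -/
theorem Progress.bid {r : ℕ} (h : Progress adj S A cur next price owner r) (hc : cur ≠ 0)
    {b : ℕ} (hb : b < S)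
    (hadj : adj cur b) (hmin : ∀ j < S, adj cur j → price b ≤ price j) :
    Progress adj S A (owner b) next (Function.update price b (price b + 1))
      (Function.update owner b cur) (r + 1) where
  toInv := h.toInv.bid hc hb hadj hmin
  price_bound hM j hj := by
    rcases eq_or_ne j b with rfl | hjb
    · simpa using h.toInv.price_le_of_hasMatching hM hc hb hmin
    · simpa [hjb] using h.price_bound hM j hj
  progress hM := by
    right
    rw [Finset.sum_update_of_mem (Finset.mem_range.2 hb)]
    have h1 := (h.progress hM).resolve_left (fun h => hc h.1)
    rw [← Finset.add_sum_erase _ _ (Finset.mem_range.2 hb), ← Finset.sdiff_singleton_eq_erase] at h1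
    omega

/-- If a matching exists, `S` prices of at most `S + 1` cannot add up to `r`, so the auction has
ended. Conversely, at the end the owners form a matching. -/
theorem Progress.done_iff {r : ℕ} (h : Progress adj S A cur next price owner r)
    (hr : S * (S + 1) < r) : (cur = 0 ∧ next = A) ↔ HasMatching adj S A := by
  constructor
  · rintro ⟨rfl, rfl⟩
    exact h.toInv.hasMatching
  · intro hM
    refine (h.progress hM).resolve_right fun h1 => ?_
    have : ∑ j ∈ Finset.range S, price j ≤ _ := Finset.sum_le_card_nsmul _ price (S + 1)
      fun j hj => h.price_bound hM j (Finset.mem_range.1 hj)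
    simp only [Finset.card_range, smul_eq_mul] at this
    omega

end Auction

/-! ### Frame conditions: what a program leaves unchanged -/

namespace RAM

namespace Prog

infixr:60 " ;; " => Prog.seq

/-- The states `s` and `r` agree on everything that `c` does not overwrite. -/
def Frame (c : Prog) (s r : State) : Prop :=
  (∀ v, v ∉ c.writes → r.var v = s.var v) ∧ ∀ a, a ∉ c.stores → r.arr a = s.arr a

theorem Frame.refl (c : Prog) (s : State) : Frame c s s := ⟨fun _ _ => rfl, fun _ _ => rfl⟩

theorem frame_den (c : Prog) (s : State) : Frame c s (c.den s) :=
  ⟨fun _ h => den_var c s h, fun _ h => den_arr c s h⟩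

/-- The side conditions are inclusions between explicit lists of numbers, so `decide` settles them
for concrete programs. -/
theorem Frame.trans {c d : Prog} {s r q : State} (h : Frame c s r) (h' : Frame d r q)
    (hw : ∀ v ∈ d.writes, v ∈ c.writes) (hs : ∀ a ∈ d.stores, a ∈ c.stores) : Frame c s q :=
  ⟨fun v hv => (h'.1 v fun h1 => hv (hw v h1)).trans (h.1 v hv),
    fun a ha => (h'.2 a fun h1 => ha (hs a h1)).trans (h.2 a ha)⟩

theorem Frame.den {c d : Prog} {s r : State} (h : Frame c s r)
    (hw : ∀ v ∈ d.writes, v ∈ c.writes) (hs : ∀ a ∈ d.stores, a ∈ c.stores) :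
    Frame c s (d.den r) :=
  h.trans (frame_den d r) hw hs

theorem Frame.setVar {c : Prog} {s r : State} (h : Frame c s r) {x : ℕ} (k : ℕ)
    (hx : x ∈ c.writes) : Frame c s (r.setVar x k) :=
  ⟨fun v hv => by
    have : v ≠ x := fun e => hv (e ▸ hx)
    simpa [State.setVar, this] using h.1 v hv, h.2⟩

end Prog

/-! ## The registers and arrays of the decision procedures -/

notation "rM" => (2 : ℕ)
notation "rN" => (3 : ℕ)
notation "rS" => (26 : ℕ)
notation "rCur" => (28 : ℕ)
notation "rNext" => (29 : ℕ)
notation "rAgents" => (30 : ℕ)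
notation "rJ" => (35 : ℕ)
notation "rBest" => (37 : ℕ)
notation "rTmp" => (38 : ℕ)
notation "rX" => (16 : ℕ)
notation "rY" => (18 : ℕ)
notation "aMem" => (3 : ℕ)
notation "aBase" => (4 : ℕ)
notation "aCand" => (5 : ℕ)
notation "aPrice" => (6 : ℕ)
notation "aOwner" => (7 : ℕ)

open Prog

/-- Nonzero if the slot `rJ` is acceptable to the agent `rCur`. -/
def adjE : Expr :=
  .get aMem (.get aBase (.var rCur) + .get aCand (.var rJ)) +
    ((.const 1 - (.var rN - .var rCur)) -
      ((Expr.get aCand (.var rJ)).eqE (.var rX) + (Expr.get aCand (.var rJ)).eqE (.var rY)))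

/-- Let `rBest` be `0` or one more than the cheapest slot that is acceptable to `rCur`. -/
def findBest : Prog :=
  .assign rBest (.const 0) ;;
  .upto rJ 36 (.var rS)
    (.ite adjE
      (.ite ((Expr.var rBest).eqE (.const 0) +
          (Expr.get aPrice (.var rJ)).ltE (.get aPrice (.var rBest - .const 1)))
        (.assign rBest (.var rJ + .const 1)) .skip) .skip)

/-- The agent `rCur` bids for the slot `rBest - 1`. -/
def bid : Prog :=
  .ite (.var rBest)
    (.store aPrice (.var rBest - .const 1) (.get aPrice (.var rBest - .const 1) + .const 1) ;;
    .assign rTmp (.get aOwner (.var rBest - .const 1)) ;;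
    .store aOwner (.var rBest - .const 1) (.var rCur) ;;
    .assign rCur (.var rTmp)) .skip

/-- If nobody is bidding, then the next agent enters. -/
def enter : Prog :=
  .ite (.var rCur) .skip
    (.ite (.var rAgents - .var rNext)
      (.assign rCur (.var rNext) ;; .assign rNext (.var rNext + .const 1)) .skip)

/-- One step of the auction. -/
def auctionStep : Prog := enter ;; .ite (.var rCur) (findBest ;; bid) .skip

/-- The start of the auction. -/
def auctionInit : Prog :=
  .upto rJ 36 (.var rS)
    (.store aPrice (.var rJ) (.const 0) ;; .store aOwner (.var rJ) (.const 0)) ;;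
  .assign rCur (.const 0) ;; .assign rNext (.const 1)

/-- The auction. -/
def auction : Prog :=
  auctionInit ;; .upto 31 32 (.var 1) (.upto 33 34 (.var 1) auctionStep)

theorem findBest_spec {s : State} {S : ℕ} (adj : ℕ → Prop)
    (hS : s.var rS = S) (hSL : S ≤ s.var 1)
    (hadj : ∀ r, Frame findBest s r → r.var rJ < S → (adjE.eval r ≠ 0 ↔ adj (r.var rJ))) :
    ((findBest.den s).var rBest = 0 ∧ ∀ j < S, ¬ adj j) ∨
      ∃ b < S, (findBest.den s).var rBest = b + 1 ∧ adj b ∧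
        ∀ j < S, adj j → s.arr aPrice b ≤ s.arr aPrice j := by
  have key := upto_induction (x := rJ) (h := 36) (e := .var rS)
    (s := (Prog.assign rBest (.const 0)).den s) (N := S)
    (c := (.ite adjE
      (.ite ((Expr.var rBest).eqE (.const 0) +
          (Expr.get aPrice (.var rJ)).ltE (.get aPrice (.var rBest - .const 1)))
        (.assign rBest (.var rJ + .const 1)) .skip) .skip))
    (by simpa [den, State.setVar, Expr.eval] using hS) (by simpa [den, State.setVar] using hSL)
    (fun k r => Frame findBest s r ∧ ((r.var rBest = 0 ∧ ∀ j < k, ¬ adj j) ∨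
      ∃ b < k, r.var rBest = b + 1 ∧ adj b ∧
        ∀ j < k, adj j → s.arr aPrice b ≤ s.arr aPrice j)) ?_ ?_
  · exact key.2
  · refine ⟨(((Frame.refl findBest s).den (by decide) (by decide)).setVar _ (by decide)).setVar _
      (by decide), .inl ⟨by simp [den, State.setVar, Expr.eval], by simp⟩⟩
  · rintro k r hk hJ ⟨hF, hI⟩
    refine ⟨(hF.den (by decide) (by decide)).setVar _ (by decide), ?_⟩
    have hp : r.arr aPrice = s.arr aPrice := hF.2 _ (by decide)
    have ha := hadj r hF (by omega)
    rw [hJ] at ha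
    by_cases hk' : adj k
    · have hne := ha.2 hk'
      rcases hI with ⟨h0, h1⟩ | ⟨b, hb, h0, h1, h2⟩
      · right
        refine ⟨k, by omega, ?_, hk', fun j hj hja => ?_⟩
        · simp [den, hne, eval_add, eval_eqE, eval_ltE, eval_var, eval_const, h0, State.setVar,
            hJ]
        · rcases Nat.lt_succ_iff_lt_or_eq.1 hj with hj | rfl
          · exact (h1 j hj hja).elim
          · exact le_rfl
      · right
        by_cases hlt : s.arr aPrice k < s.arr aPrice b
        · refine ⟨k, by omega, ?_, hk', fun j hj hja => ?_⟩
          · simp [den, hne, eval_add, eval_eqE, eval_ltE, eval_var, eval_const, eval_get,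
              eval_sub, h0, State.setVar, hJ, hp, hlt]
          · rcases Nat.lt_succ_iff_lt_or_eq.1 hj with hj | rfl
            · exact hlt.le.trans (h2 j hj hja)
            · exact le_rfl
        · refine ⟨b, by omega, ?_, h1, fun j hj hja => ?_⟩
          · simp [den, hne, eval_add, eval_eqE, eval_ltE, eval_var, eval_const, eval_get,
              eval_sub, h0, State.setVar, hJ, hp, hlt]
          · rcases Nat.lt_succ_iff_lt_or_eq.1 hj with hj | rfl
            · exact h2 j hj hja
            · exact not_lt.1 hlt
    · have hz : adjE.eval r = 0 := by
        by_contra h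
        exact hk' (ha.1 h)
      rcases hI with ⟨h0, h1⟩ | ⟨b, hb, h0, h1, h2⟩
      · left
        refine ⟨by simp [den, hz, State.setVar, h0], fun j hj hja => ?_⟩
        rcases Nat.lt_succ_iff_lt_or_eq.1 hj with hj | rfl
        · exact h1 j hj hja
        · exact hk' hja
      · right
        refine ⟨b, by omega, by simp [den, hz, State.setVar, h0], h1, fun j hj hja => ?_⟩
        rcases Nat.lt_succ_iff_lt_or_eq.1 hj with hj | rfl
        · exact h2 j hj hja
        · exact (hk' hja).elim

/-- The progress of the auction in a state of the machine. -/
def AuctionAt (adj : ℕ → ℕ → Prop) (S A : ℕ) (r : State) (k : ℕ) : Prop :=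
  Auction.Progress adj S A (r.var rCur) (r.var rNext) (r.arr aPrice) (r.arr aOwner) k

/-- Either nobody is left to bid and the auction is over; or the bidder accepts no slot, so that no
matching exists and the claims conditional on `HasMatching` are vacuous; or `Progress.bid` applies.
Hence the counter may grow in every case. -/
theorem auctionStep_spec {s r : State} {S A : ℕ} (adj : ℕ → ℕ → Prop)
    (hS : s.var rS = S) (hA : s.var rAgents = A) (hSL : S ≤ s.var 1)
    (hadj : ∀ r, Frame auction s r → r.var rCur < A → r.var rJ < S →
      (adjE.eval r ≠ 0 ↔ adj (r.var rCur) (r.var rJ)))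
    (hF : Frame auction s r) {k : ℕ} (h : AuctionAt adj S A r k) :
    AuctionAt adj S A (auctionStep.den r) (k + 1) := by
  have hA' : r.var rAgents = A := (hF.1 _ (by decide)).trans hA
  -- after somebody entered
  have h1 : AuctionAt adj S A (enter.den r) k ∧
      ((enter.den r).var rCur = 0 → (enter.den r).var rNext = A) := by
    rw [enter, den]
    split_ifs with hc
    · rw [den]
      rw [eval_var] at hc
      rw [eval_sub, eval_var, eval_var, hA']
      have hle := h.next_le
      unfold AuctionAt at h ⊢
      split_ifs with hn
      · exact ⟨h, fun _ => by simp only [den]; omega⟩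
      · rw [hc] at h
        refine ⟨⟨?_, ?_, fun hM => .inr ?_⟩, ?_⟩
        · simpa [den, State.setVar, Expr.eval, eval_add] using h.toInv.take (by omega)
        · simpa [den, State.setVar] using h.price_bound
        · have := (h.progress hM).resolve_left (fun h => by omega)
          simpa [den, State.setVar] using this
        · have := h.next_pos
          simp [den, State.setVar, eval_var, eval_add, eval_const]
          omega
    · exact ⟨h, fun h0 => (hc h0).elim⟩
  have hF1 : Frame auction s (enter.den r) := hF.den (by decide) (by decide)
  rw [auctionStep, den]
  generalize enter.den r = q at *
  obtain ⟨h1, h2⟩ := h1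
  rw [den]
  split_ifs with hc
  · rw [eval_var] at hc
    exact ⟨h1.toInv, h1.price_bound, fun _ => .inl ⟨hc, h2 hc⟩⟩
  rw [eval_var] at hc
  have hSq : q.var rS = S := (hF1.1 _ (by decide)).trans hS
  have h1q : q.var 1 = s.var 1 := hF1.1 _ (by decide)
  have hlt : q.var rCur < A := h1.cur_lt.trans_le h1.next_le
  have hfb := findBest_spec (s := q) (adj (q.var rCur)) hSq (by omega) (by
    intro r' hr' hJ
    have e : r'.var rCur = q.var rCur := hr'.1 _ (by decide)
    rw [← e]
    exact hadj r' (hF1.trans hr' (by decide) (by decide)) (by omega) hJ)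
  rw [den]
  have hF2 := frame_den findBest q
  generalize findBest.den q = q' at *
  have e1 : q'.var rCur = q.var rCur := hF2.1 _ (by decide)
  have e2 : q'.var rNext = q.var rNext := hF2.1 _ (by decide)
  have e3 : q'.arr = q.arr := funext fun a => hF2.2 a (by simp [findBest, stores])
  rcases hfb with ⟨h0, hno⟩ | ⟨b, hb, hbe, hab, hmin⟩
  · have : bid.den q' = q' := by simp [bid, den, eval_var, h0]
    rw [this]
    unfold AuctionAt at h1 ⊢
    rw [e1, e2, e3]
    refine ⟨h1.toInv, h1.price_bound, fun hM => ?_⟩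
    obtain ⟨μ, hμ, -⟩ := hM
    have := hμ _ (by omega) hlt
    exact (hno _ this.1 this.2).elim
  · have h3 := h1.bid hc hb hab hmin
    unfold AuctionAt
    convert h3 using 1
    · simp [bid, den, eval_var, hbe, eval_sub, eval_const, eval_get, State.setVar,
        State.setArr, e3]
    · simp [bid, den, eval_var, hbe, State.setVar, State.setArr, e2]
    · simp [bid, den, eval_var, hbe, eval_sub, eval_const, eval_get, State.setVar, eval_add,
        State.setArr, e3]
    · simp [bid, den, eval_var, hbe, eval_sub, eval_const, eval_get, State.setVar, eval_add,
        State.setArr, e3, e1]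

/-- The auction finds out if the agents can be matched. -/
theorem auction_spec {s : State} {S A : ℕ} (adj : ℕ → ℕ → Prop)
    (hS : s.var rS = S) (hA : s.var rAgents = A) (hA1 : 1 ≤ A) (hSL : S + 2 ≤ s.var 1)
    (hadj : ∀ r, Frame auction s r → r.var rCur < A → r.var rJ < S →
      (adjE.eval r ≠ 0 ↔ adj (r.var rCur) (r.var rJ))) :
    ((auction.den s).var rCur = 0 ∧ (auction.den s).var rNext = A) ↔
      Auction.HasMatching adj S A := by
  obtain ⟨L, hL⟩ : ∃ L, s.var 1 = L := ⟨_, rfl⟩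
  have h0 : AuctionAt adj S A (auctionInit.den s) 0 := by
    have := upto_induction (x := rJ) (h := 36) (e := .var rS) (s := s) (N := S)
      (c := .store aPrice (.var rJ) (.const 0) ;; .store aOwner (.var rJ) (.const 0))
      hS (by omega)
      (fun k r => ∀ j < k, r.arr aPrice j = 0 ∧ r.arr aOwner j = 0) (by simp) (by
        intro k r hk hJ hI j hj
        rcases Nat.lt_succ_iff_lt_or_eq.1 hj with hj | rfl
        · simp [den, State.setVar, State.setArr, eval_var, eval_const, hJ,
            hj.ne, hI j hj]
        · simp [den, State.setVar, State.setArr, eval_var, eval_const, hJ])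
    rw [auctionInit, den, den]
    generalize den (.upto rJ _ _ _) s = r at *
    refine ⟨?_, fun _ j hj => ?_, fun _ => .inr (Nat.zero_le _)⟩
    · simpa [den, State.setVar, eval_const] using
        Auction.inv_init hA1 (fun j hj => (this j hj).1) (fun j hj => (this j hj).2)
    · simp [den, State.setVar, (this j hj).1]
  have hF0 : Frame auction s (auctionInit.den s) :=
    (Frame.refl _ _).den (by decide) (by decide)
  have key := upto_induction (x := 31) (h := 32) (e := .var 1) (s := auctionInit.den s) (N := L)
    (c := .upto 33 34 (.var 1) auctionStep)
    ((hF0.1 1 (by decide)).trans hL) (le_of_eq (hL.symm.trans (hF0.1 1 (by decide)).symm))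
    (fun k r => Frame auction s r ∧ AuctionAt adj S A r (k * L))
    ⟨(hF0.setVar _ (by decide)).setVar _ (by decide), by
      simpa [AuctionAt, State.setVar] using h0⟩ (by
    rintro k r hk - ⟨hF, hI⟩
    have hL' : r.var 1 = L := (hF.1 1 (by decide)).trans hL
    have := upto_induction (x := 33) (h := 34) (e := .var 1) (s := r) (N := L)
      (c := auctionStep) hL' (by omega)
      (fun k' r => Frame auction s r ∧ AuctionAt adj S A r (k * L + k'))
      ⟨(hF.setVar _ (by decide)).setVar _ (by decide), by
        simpa [AuctionAt, State.setVar] using hI⟩ (by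
        rintro k' r' hk' - ⟨hF', hI'⟩
        have := auctionStep_spec adj hS hA (by omega) hadj hF' hI'
        exact ⟨(hF'.den (by decide) (by decide)).setVar _ (by decide), by
          simpa [AuctionAt, State.setVar, add_assoc] using this⟩)
    refine ⟨this.1.setVar _ (by decide), ?_⟩
    rw [Nat.succ_mul]
    simpa [AuctionAt, State.setVar] using this.2)
  -- The two nested loops make `L * L` steps, and `L ≥ S + 2` gives `L * L > S * (S + 1)`.
  exact key.2.done_iff (by nlinarith)

end RAM

/-! ### Vote counts as matchings of voters and dummies into slots -/

namespace Auction

/-- The number of the voters `1, …, n - 1` to whom `t` assigns the candidate `d`. -/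
def voteCount (n : ℕ) (t : ℕ → ℕ) (d : ℕ) : ℕ := ((Finset.Ico 1 n).filter fun i => t i = d).card

theorem exists_injOn_of_card_le {α β : Type*} [Nonempty β] {s : Finset α} {u : Finset β}
    (h : s.card ≤ u.card) : ∃ μ : α → β, (∀ a ∈ s, μ a ∈ u) ∧ Set.InjOn μ s := by
  obtain ⟨μ, h1, h2⟩ := s.finite_toSet.exists_injOn_of_encard_le (t := (u : Set β))
    (by simpa [Set.encard_coe_eq_coe_finsetCard] using h)
  exact ⟨μ, fun a ha => h1 ha, h2⟩

/-- Injections that respect labels exist if there are enough targets of every label. -/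
theorem exists_injOn_of_card_filter_le {α β γ : Type*} [DecidableEq γ] (s : Finset α)
    (u : Finset β) [Nonempty β] (f : α → γ) (g : β → γ)
    (h : ∀ c, (s.filter fun a => f a = c).card ≤ (u.filter fun b => g b = c).card) :
    ∃ μ : α → β, (∀ a ∈ s, μ a ∈ u ∧ g (μ a) = f a) ∧ Set.InjOn μ s := by
  have : ∀ c, ∃ μ : α → β, (∀ a ∈ s.filter fun a => f a = c, μ a ∈ u.filter fun b => g b = c) ∧
      Set.InjOn μ (s.filter fun a => f a = c) := by
    intro c
    exact exists_injOn_of_card_le (h c)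
  choose μ h1 h2 using this
  refine ⟨fun a => μ (f a) a, fun a ha => ?_, fun a ha b hb hab => ?_⟩
  · simpa using h1 (f a) a (by simpa using ha)
  · have ea : g (μ (f a) a) = f a := by
      have := h1 (f a) a (by simpa using ha)
      exact (Finset.mem_filter.1 this).2
    have eb : g (μ (f b) b) = f b := by
      have := h1 (f b) b (by simpa using hb)
      exact (Finset.mem_filter.1 this).2
    have hf : f a = f b := by
      rw [← ea, ← eb]
      exact congrArg g hab
    refine h2 (f a) (by simpa using ha) (by simpa [hf] using hb) ?_
    simpa [← hf] using hab

/-- The voters `1, …, n - 1` can choose among their candidates `T` in such a way that no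
candidate gets more votes than it has slots and `x` and `y` get as many votes as they have slots,
if and only if voters and dummies can be matched into the slots, where the slots of `x` and `y`
are not acceptable to dummies. -/
theorem hasMatching_iff {n S A : ℕ} (T : ℕ → ℕ → Prop) (cand : ℕ → ℕ) (x y : ℕ)
    (hn : 1 ≤ n) (hA : A = n + (S + 1 - n)) :
    HasMatching (fun i j => (i < n ∧ T i (cand j)) ∨ (n ≤ i ∧ cand j ≠ x ∧ cand j ≠ y)) S A ↔
      ∃ t : ℕ → ℕ, (∀ i, 1 ≤ i → i < n → T i (t i)) ∧
        voteCount n t x = Nat.count (fun j => cand j = x) S ∧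
        voteCount n t y = Nat.count (fun j => cand j = y) S ∧
        ∀ d, voteCount n t d ≤ Nat.count (fun j => cand j = d) S := by
  simp only [Nat.count_eq_card_filter_range, voteCount]
  constructor
  · rintro ⟨μ, h1, h2⟩
    have hinj : Set.InjOn μ (Finset.Ico 1 A) := by
      intro i hi j hj hij
      simp only [Finset.coe_Ico, Set.mem_Ico] at hi hj
      exact h2 i j hi.1 hi.2 hj.1 hj.2 hij
    -- By the choice of `A` there are at least `S` agents, so an injection of them into the slots
    -- uses every slot.
    have himg : (Finset.Ico 1 A).image μ = Finset.range S := by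
      refine Finset.eq_of_subset_of_card_le (fun j hj => ?_) ?_
      · obtain ⟨i, hi, rfl⟩ := Finset.mem_image.1 hj
        rw [Finset.mem_Ico] at hi
        exact Finset.mem_range.2 (h1 i hi.1 hi.2).1
      · rw [Finset.card_image_of_injOn hinj, Nat.card_Ico, Finset.card_range]
        omega
    have hle : ∀ d, ((Finset.Ico 1 n).filter fun i => cand (μ i) = d).card ≤
        ((Finset.range S).filter fun j => cand j = d).card := by
      intro d
      refine Finset.card_le_card_of_injOn μ (fun i hi => ?_) (hinj.mono fun i hi => ?_)
      · simp only [Finset.coe_filter, Finset.mem_Ico, Set.mem_ofPred_eq] at hi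
        simp only [Finset.coe_filter, Finset.mem_range, Set.mem_ofPred_eq]
        exact ⟨(h1 i (by omega) (by omega)).1, hi.2⟩
      · simp only [Finset.coe_filter, Finset.mem_Ico, Set.mem_ofPred_eq] at hi
        simp only [Finset.coe_Ico, Set.mem_Ico]
        omega
    -- All slots of `x` and `y` are taken, and not by dummies, hence by voters.
    have hge : ∀ d, d = x ∨ d = y → ((Finset.range S).filter fun j => cand j = d).card ≤
        ((Finset.Ico 1 n).filter fun i => cand (μ i) = d).card := by
      intro d hd
      refine Finset.card_le_card_of_surjOn μ fun j hj => ?_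
      simp only [Finset.coe_filter, Finset.mem_range, Set.mem_ofPred_eq] at hj
      have : j ∈ (Finset.Ico 1 A).image μ := himg ▸ Finset.mem_range.2 hj.1
      obtain ⟨i, hi, rfl⟩ := Finset.mem_image.1 this
      rw [Finset.mem_Ico] at hi
      refine ⟨i, ?_, rfl⟩
      simp only [Finset.coe_filter, Finset.mem_Ico, Set.mem_ofPred_eq]
      rcases (h1 i hi.1 hi.2).2 with h | h
      · exact ⟨⟨hi.1, h.1⟩, hj.2⟩
      · rcases hd with rfl | rfl
        · exact (h.2.1 hj.2).elim
        · exact (h.2.2 hj.2).elim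
    refine ⟨fun i => cand (μ i), fun i h3 h4 => ?_, (hle x).antisymm (hge x (.inl rfl)),
      (hle y).antisymm (hge y (.inr rfl)), hle⟩
    rcases (h1 i h3 (by omega)).2 with h | h
    · exact h.2
    · omega
  · rintro ⟨t, hT, hx, hy, hle⟩
    obtain ⟨μ, h1, h2⟩ := exists_injOn_of_card_filter_le _ _ t cand hle
    have hsub : (Finset.Ico 1 n).image μ ⊆ Finset.range S := by
      intro j hj
      obtain ⟨i, hi, rfl⟩ := Finset.mem_image.1 hj
      exact (h1 i hi).1
    have hcard := Finset.card_le_card hsub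
    have himg := Finset.card_image_of_injOn h2
    have hrest := Finset.card_sdiff_of_subset hsub
    rw [himg, Nat.card_Ico, Finset.card_range] at hrest
    rw [himg, Nat.card_Ico, Finset.card_range] at hcard
    -- The `A - n` dummies are distributed in any way over the equally many slots that the voters
    -- left free.
    obtain ⟨ν, h3, h4⟩ : ∃ ν : ℕ → ℕ,
        (∀ i ∈ Finset.Ico n A, ν i ∈ Finset.range S \ (Finset.Ico 1 n).image μ) ∧
        Set.InjOn ν (Finset.Ico n A) := by
      refine exists_injOn_of_card_le ?_
      rw [hrest, Nat.card_Ico]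
      omega
    -- the slots of `x` and `y` have all been taken
    have hfull : ∀ d, ((Finset.Ico 1 n).filter fun i => t i = d).card =
        ((Finset.range S).filter fun j => cand j = d).card →
        ∀ j < S, cand j = d → j ∈ (Finset.Ico 1 n).image μ := by
      intro d hd j hj hjd
      have : ((Finset.Ico 1 n).filter fun i => t i = d).image μ =
          (Finset.range S).filter fun j => cand j = d := by
        refine Finset.eq_of_subset_of_card_le (fun j hj => ?_) ?_
        · obtain ⟨i, hi, rfl⟩ := Finset.mem_image.1 hj
          rw [Finset.mem_filter] at hi ⊢
          exact ⟨(h1 i hi.1).1, (h1 i hi.1).2.trans hi.2⟩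
        · rw [Finset.card_image_of_injOn (h2.mono fun i hi => (Finset.mem_filter.1 hi).1), hd]
      have hj' : j ∈ (Finset.range S).filter fun j => cand j = d :=
        Finset.mem_filter.2 ⟨Finset.mem_range.2 hj, hjd⟩
      rw [← this] at hj'
      exact Finset.image_subset_image (Finset.filter_subset _ _) hj'
    refine ⟨fun i => if i < n then μ i else ν i, fun i hi hiA => ?_,
      fun i j hi hiA hj hjA hij => ?_⟩
    · dsimp only
      split_ifs with hin
      · have := h1 i (Finset.mem_Ico.2 ⟨hi, hin⟩)
        refine ⟨Finset.mem_range.1 this.1, .inl ⟨hin, ?_⟩⟩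
        rw [this.2]
        exact hT i hi hin
      · have := h3 i (Finset.mem_Ico.2 ⟨by omega, hiA⟩)
        rw [Finset.mem_sdiff, Finset.mem_range] at this
        exact ⟨this.1, .inr ⟨by omega, fun h => this.2 (hfull x hx _ this.1 h),
          fun h => this.2 (hfull y hy _ this.1 h)⟩⟩
    · have cross : ∀ i j, 1 ≤ i → i < n → n ≤ j → j < A → μ i ≠ ν j := by
        intro i j h5 h6 h7 h8 h9
        have := (Finset.mem_sdiff.1 (h3 j (Finset.mem_Ico.2 ⟨h7, h8⟩))).2
        exact this (h9 ▸ Finset.mem_image_of_mem μ (Finset.mem_Ico.2 ⟨h5, h6⟩))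
      dsimp only at hij
      split_ifs at hij with h5 h6 h6
      · exact h2 (by simpa using ⟨hi, h5⟩) (by simpa using ⟨hj, h6⟩) hij
      · exact (cross i j hi h5 (by omega) hjA hij).elim
      · exact (cross j i hj h6 (by omega) hiA hij.symm).elim
      · exact h4 (by simp; omega) (by simp; omega) hij

end Auction

/-! ### From guessed winners and scores to slots -/

namespace RAM

open Prog

/-- What the decision procedures have to know about a game: the numbers `m` and `n` of candidates
and voters, a bound `L` on the loops, the positions `tp` and `pp` of the candidates in the
tie-breaking order and in the preferences of voter 1, and the candidates `T i` that voter `i`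
may vote for. -/
structure GameData where
  m : ℕ
  n : ℕ
  L : ℕ
  tp : ℕ → ℕ
  pp : ℕ → ℕ
  T : ℕ → ℕ → Prop

/-- The data are stored in the memory. -/
structure Env (D : GameData) (s : State) : Prop where
  hL : s.var 1 = D.L
  hm : s.var rM = D.m
  hn : s.var rN = D.n
  one_le_n : 1 ≤ D.n
  le_L : D.m * D.n + D.m + D.n + 2 ≤ D.L
  htp : ∀ d < D.m, s.arr 1 d = D.tp d
  hpp : ∀ d < D.m, s.arr 2 d = D.pp d
  hT : ∀ i < D.L, ∀ d < D.m, (s.arr aMem (s.arr aBase i + d) ≠ 0 ↔ i < D.n ∧ D.T i d)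

theorem Env.frame {D : GameData} {c : Prog} {s r : State} (h : Env D s) (hF : Frame c s r)
    (hc : (∀ v ∈ [1, rM, rN], v ∉ c.writes) ∧ ∀ a ∈ [1, 2, aMem, aBase], a ∉ c.stores) :
    Env D r where
  hL := (hF.1 _ (hc.1 _ (by simp))).trans h.hL
  hm := (hF.1 _ (hc.1 _ (by simp))).trans h.hm
  hn := (hF.1 _ (hc.1 _ (by simp))).trans h.hn
  one_le_n := h.one_le_n
  le_L := h.le_L
  htp := by rw [hF.2 1 (hc.2 _ (by simp))]; exact h.htp
  hpp := by rw [hF.2 2 (hc.2 _ (by simp))]; exact h.hpp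
  hT := by rw [hF.2 aMem (hc.2 _ (by simp)), hF.2 aBase (hc.2 _ (by simp))]; exact h.hT

namespace GameData

/-- If `d` has `k` votes of the voters other than voter 1, then `d` does not prevent `x` with `U`
such votes from winning when voter 1 votes for `a`. -/
def OkOne (D : GameData) (a x U d k : ℕ) : Prop :=
  k + (if d = a then 1 else 0) + (if D.tp d < D.tp x then 1 else 0) ≤
    U + (if x = a then 1 else 0)

instance (D : GameData) (a x U d k : ℕ) : Decidable (D.OkOne a x U d k) :=
  inferInstanceAs (Decidable (_ ≤ _))

/-- If `d` has `k` votes of the voters other than voter 1, then `d` neither prevents `x` with `U`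
such votes from winning when voter 1 votes for `a` nor `y` with `W` such votes when voter 1 votes
for `b`. -/
def Ok (D : GameData) (a b x y U W d k : ℕ) : Prop := D.OkOne a x U d k ∧ D.OkOne b y W d k

instance (D : GameData) (a b x y U W d k : ℕ) : Decidable (D.Ok a b x y U W d k) :=
  inferInstanceAs (Decidable (_ ∧ _))

/-- The voters other than voter 1 can vote in such a way that `x` and `y` get `U` and `W` votes
and win when voter 1 votes for `a` and `b`, respectively, where voter 1 prefers `x` to `y`. -/
def Feasible (D : GameData) (a b x y U W : ℕ) : Prop :=
  D.pp x < D.pp y ∧ ∃ t : ℕ → ℕ, (∀ i, 1 ≤ i → i < D.n → t i < D.m ∧ D.T i (t i)) ∧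
    Auction.voteCount D.n t x = U ∧ Auction.voteCount D.n t y = W ∧
    ∀ d < D.m, D.Ok a b x y U W d (Auction.voteCount D.n t d)

end GameData

notation "rA" => (14 : ℕ)
notation "rB" => (15 : ℕ)
notation "rU" => (20 : ℕ)
notation "rW" => (22 : ℕ)
notation "rD" => (24 : ℕ)
notation "rF" => (27 : ℕ)
notation "rG" => (39 : ℕ)
notation "rK" => (40 : ℕ)

/-- Zero if and only if `OkOne` holds. -/
def notOkOne (a x U : ℕ) (d k : Expr) : Expr :=
  (k + d.eqE (.var a) + (Expr.get 1 d).ltE (.get 1 (.var x))) -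
    (.var U + (Expr.var x).eqE (.var a))

/-- Zero if and only if `Ok` holds. -/
def notOk (d k : Expr) : Expr := notOkOne rA rX rU d k + notOkOne rB rY rW d k

/-- Make a list of the slots. -/
def makeSlots : Prog :=
  .assign rS (.const 0) ;;
  .upto rD 25 (.var rM)
    (.assign rF (.var rF - notOk (.var rD) (.const 0)) ;;
    .upto rK 41 (.var rN)
      (.ite (notOk (.var rD) (.var rK + .const 1)) .skip
        (.store aCand (.var rS) (.var rD) ;; .assign rS (.var rS + .const 1))))

/-- Check the conditions on the scores of `rX` and `rY`. -/
def checkPair : Prog :=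
  .assign rF (.const 1 - (notOk (.var rX) (.var rU) + notOk (.var rY) (.var rW) +
    ((Expr.get 2 (.var rX) + .const 1) - .get 2 (.var rY))))

/-- The computations for `testPair`. -/
def preparePair : Prog :=
  checkPair ;; makeSlots ;;
  .assign rAgents (.var rN + (.var rS + .const 1 - .var rN)) ;; auction

/-- Set `rG` to `1` in case of `Feasible`. -/
def testPair : Prog :=
  preparePair ;;
  .ite (.var rF - (.var rCur + (.const 1 - (Expr.var rNext).eqE (.var rAgents))))
    (.assign rG (.const 1)) .skip

theorem eval_notOkOne_eq_zero {D : GameData} {s : State} (h : Env D s) {a x U : ℕ}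
    (hx : s.var x < D.m) {d k : Expr} (hd : d.eval s < D.m) :
    (notOkOne a x U d k).eval s = 0 ↔
      D.OkOne (s.var a) (s.var x) (s.var U) (d.eval s) (k.eval s) := by
  rw [GameData.OkOne, ← h.htp _ hx, ← h.htp _ hd, ← Nat.sub_eq_zero_iff_le]
  simp only [notOkOne, eval_add, eval_sub, eval_eqE, eval_ltE, eval_var, eval_get]
  exact Iff.rfl

theorem eval_notOk_eq_zero {D : GameData} {s : State} (h : Env D s)
    (hx : s.var rX < D.m) (hy : s.var rY < D.m) {d k : Expr} (hd : d.eval s < D.m) :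
    (notOk d k).eval s = 0 ↔ D.Ok (s.var rA) (s.var rB) (s.var rX) (s.var rY) (s.var rU)
      (s.var rW) (d.eval s) (k.eval s) := by
  rw [notOk, eval_add, Nat.add_eq_zero_iff, eval_notOkOne_eq_zero h hx hd,
    eval_notOkOne_eq_zero h hy hd, GameData.Ok]

theorem count_update (cand : ℕ → ℕ) (S c d : ℕ) :
    Nat.count (fun j => Function.update cand S c j = d) (S + 1) =
      Nat.count (fun j => cand j = d) S + if c = d then 1 else 0 := by
  rw [Nat.count_succ, Function.update_self, Nat.count_eq_card_filter_range,
    Nat.count_eq_card_filter_range]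
  congr 2
  refine Finset.filter_congr fun j hj => ?_
  rw [Function.update_of_ne (Finset.mem_range.1 hj).ne]

/-- The slots in a state of the machine: there are `f d` of them for the candidate `d`. -/
structure Slots (r : State) (m S : ℕ) (f : ℕ → ℕ) : Prop where
  le : r.var rS ≤ S
  cand_lt : ∀ j < r.var rS, r.arr aCand j < m
  count_eq : ∀ d, Nat.count (fun j => r.arr aCand j = d) (r.var rS) = f d

theorem Slots.setVar {r : State} {m S : ℕ} {f g : ℕ → ℕ} (h : Slots r m S f) {x : ℕ} (k : ℕ)
    (hx : rS ≠ x) (hg : ∀ d, f d = g d) : Slots (r.setVar x k) m S g := by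
  have e : (r.setVar x k).var rS = r.var rS := by simp [State.setVar, hx]
  refine ⟨by rw [e]; exact h.le, by rw [e]; exact h.cand_lt, fun d => ?_⟩
  rw [e, ← hg, ← h.count_eq]
  rfl

/-- There is one slot for `d` for every `k < n` such that `k + 1` votes for `d` are harmless. The
number of slots cannot show whether already `0` votes are too many, for instance because of the vote
of voter 1, so `rF` keeps track of that. -/
theorem makeSlots_spec {D : GameData} {s : State} (h : Env D s)
    (hx : s.var rX < D.m) (hy : s.var rY < D.m) {ok : ℕ → ℕ → Prop}
    [∀ d, DecidablePred (ok d)]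
    (hok : ok = D.Ok (s.var rA) (s.var rB) (s.var rX) (s.var rY) (s.var rU) (s.var rW))
    (hF : s.var rF ≤ 1) :
    Slots (makeSlots.den s) D.m (D.m * D.n)
      (fun d => if d < D.m then Nat.count (fun k => ok d (k + 1)) D.n else 0) ∧
    (makeSlots.den s).var rF ≤ 1 ∧
    ((makeSlots.den s).var rF ≠ 0 ↔ s.var rF ≠ 0 ∧ ∀ d < D.m, ok d 0) := by
  have hle := h.le_L
  have hFr : Frame makeSlots s ((Prog.assign rS (.const 0)).den s) :=
    (Frame.refl _ _).den (by decide) (by decide)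
  have hev : ∀ r, Frame makeSlots s r → r.var rD < D.m → ∀ k : Expr,
      ((notOk (.var rD) k).eval r = 0 ↔ ok (r.var rD) (k.eval r)) := by
    intro r hr hd k
    have e : ∀ v, v ∉ makeSlots.writes → r.var v = s.var v := hr.1
    rw [hok, eval_notOk_eq_zero (h.frame hr (by decide)) (by rwa [e rX (by decide)])
      (by rwa [e rY (by decide)]) (by exact hd), e rA (by decide), e rB (by decide), e rX (by decide),
      e rY (by decide), e rU (by decide), e rW (by decide), eval_var]
  have key := upto_induction (x := rD) (h := 25) (e := .var rM)
    (s := (Prog.assign rS (.const 0)).den s) (N := D.m)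
    (c := .assign rF (.var rF - notOk (.var rD) (.const 0)) ;;
      .upto rK 41 (.var rN)
        (.ite (notOk (.var rD) (.var rK + .const 1)) .skip
          (.store aCand (.var rS) (.var rD) ;; .assign rS (.var rS + .const 1))))
    ((hFr.1 _ (by decide)).trans h.hm)
    (by rw [(h.frame hFr (by decide)).hL]; omega)
    (fun k r => Frame makeSlots s r ∧ Slots r D.m (k * D.n)
      (fun d => if d < k then Nat.count (fun k => ok d (k + 1)) D.n else 0) ∧
      r.var rF ≤ 1 ∧ (r.var rF ≠ 0 ↔ s.var rF ≠ 0 ∧ ∀ d < k, ok d 0))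
    ⟨(hFr.setVar _ (by decide)).setVar _ (by decide), ⟨by simp [den, State.setVar, eval_const],
      by simp [den, State.setVar, eval_const], by simp [den, State.setVar, eval_const]⟩,
      by simpa [den, State.setVar] using hF, by simp [den, State.setVar]⟩ ?_
  · exact key.2
  · rintro d r hd hrd ⟨hr, hS, hF1, hF2⟩
    rw [den]
    have hr1 : Frame makeSlots s ((Prog.assign rF (.var rF - notOk (.var rD) (.const 0))).den r) :=
      hr.den (by decide) (by decide)
    have h0 := hev r hr (by omega) (.const 0)
    rw [eval_const, hrd] at h0
    generalize hq : (Prog.assign rF (.var rF - notOk (.var rD) (.const 0))).den r = q at *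
    have hqF : q.var rF ≤ 1 ∧ (q.var rF ≠ 0 ↔ s.var rF ≠ 0 ∧ ∀ d' < d + 1, ok d' 0) := by
      have : q.var rF = r.var rF - (notOk (.var rD) (.const 0)).eval r := by
        simp [← hq, den, State.setVar, eval_sub, eval_var]
      rw [this, Nat.forall_lt_succ_right, ← and_assoc, ← hF2, ← h0]
      omega
    have hqS : Slots q D.m (d * D.n)
        (fun d' => if d' < d then Nat.count (fun k => ok d' (k + 1)) D.n else 0) := by
      rw [← hq]
      exact ⟨by simpa [den, State.setVar] using hS.le,
        by simpa [den, State.setVar] using hS.cand_lt,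
        by simpa [den, State.setVar] using hS.count_eq⟩
    have hqd : q.var rD = d := by
      simpa [← hq, den, State.setVar] using hrd
    have := upto_induction (x := rK) (h := 41) (e := .var rN) (s := q) (N := D.n)
      (c := .ite (notOk (.var rD) (.var rK + .const 1)) .skip
          (.store aCand (.var rS) (.var rD) ;; .assign rS (.var rS + .const 1)))
      ((h.frame hr1 (by decide)).hn) (by rw [(h.frame hr1 (by decide)).hL]; omega)
      (fun k r => Frame makeSlots s r ∧ r.var rD = d ∧ r.var rF = q.var rF ∧
        Slots r D.m (d * D.n + k)
        (fun d' => if d' < d then Nat.count (fun k => ok d' (k + 1)) D.n else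
          if d = d' then Nat.count (fun k => ok d' (k + 1)) k else 0))
      ⟨(hr1.setVar _ (by decide)).setVar _ (by decide), by simpa [State.setVar] using hqd,
        by simp [State.setVar], ?_⟩ ?_
    · obtain ⟨i1, i2, i3, i4⟩ := this
      refine ⟨i1.setVar _ (by decide), ?_, ?_, ?_⟩
      · rw [Nat.succ_mul]
        refine i4.setVar _ (by decide) fun d' => ?_
        split_ifs <;> first | rfl | omega
      · simp only [State.setVar]
        rw [Function.update_of_ne (by decide), i3]
        exact hqF.1
      · simp only [State.setVar]
        rw [Function.update_of_ne (by decide), i3]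
        exact hqF.2
    · refine (hqS.setVar (g := _) _ (by decide) fun d' => rfl).setVar _ (by decide) fun d' => ?_
      simp
    · rintro k r' hk hrk ⟨i1, i2, i3, i4⟩
      have hz := hev r' i1 (by omega) (.var rK + .const 1)
      rw [eval_add, eval_var, eval_const, hrk, i2] at hz
      refine ⟨(i1.den (by decide) (by decide)).setVar _ (by decide), ?_, ?_, ?_⟩
      · rw [← i2]
        simp only [State.setVar]
        rw [Function.update_of_ne (by decide)]
        exact den_var _ _ (by decide)
      · rw [← i3]
        simp only [State.setVar]
        rw [Function.update_of_ne (by decide)]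
        exact den_var _ _ (by decide)
      · by_cases hk' : ok d (k + 1)
        · have hz' := hz.2 hk'
          refine ⟨?_, ?_, fun d' => ?_⟩
          · have := i4.le
            simp [den, hz', State.setVar, State.setArr, eval_add, eval_var, eval_const]
            omega
          · have h1 := i4.cand_lt
            simp only [den, hz', State.setVar, State.setArr, eval_add, eval_var, eval_const]
            intro j hj
            rcases Nat.lt_succ_iff_lt_or_eq.1 (show j < r'.var rS + 1 by simpa using hj)
              with hj' | rfl
            · simpa [hj'.ne] using h1 j hj'
            · simpa [i2] using hd
          · have h1 := i4.count_eq d'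
            simp only [den, hz', State.setVar, State.setArr, eval_add, eval_var, eval_const,
              if_true, Function.update_self]
            rw [Function.update_of_ne (by decide), Function.update_self, i2, count_update, h1]
            rcases lt_trichotomy d' d with h2 | h2 | h2
            · simp [h2, h2.ne']
            · subst h2
              simp [Nat.count_succ, hk']
            · simp [h2.not_gt, h2.ne]
        · have hz' : (notOk (.var rD) (.var rK + .const 1)).eval r' ≠ 0 := fun e => hk' (hz.1 e)
          have hs : ((Prog.ite (notOk (.var rD) (.var rK + .const 1)) .skip
            (.store aCand (.var rS) (.var rD) ;; .assign rS (.var rS + .const 1))).den r') = r' := by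
            simp [den, hz']
          rw [hs]
          refine Slots.setVar ⟨i4.le.trans (by omega), i4.cand_lt, i4.count_eq⟩ _ (by decide)
            fun d' => ?_
          by_cases h2 : d = d'
          · subst h2
            simp [Nat.count_succ, hk']
          · simp [h2]

end RAM

/-! ### Feasibility of a guess, and the search over all guesses -/

namespace RAM

open Prog

/-- A downward closed `p` holds on an initial segment, and counting it measures the length of that
segment. -/
theorem le_count_iff {p : ℕ → Prop} [DecidablePred p] (hp : ∀ i j, i ≤ j → p j → p i)
    {c n : ℕ} (hc : c ≤ n) : c ≤ Nat.count p n ↔ ∀ k < c, p k := by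
  constructor
  · intro h k hk
    by_contra hpk
    obtain ⟨l, rfl⟩ := Nat.exists_eq_add_of_le (hk.le.trans hc)
    rw [Nat.count_add, (Nat.count_iff_forall_not (p := fun i => p (k + i))).2
      (fun i _ hi => hpk (hp _ _ (by omega) hi))] at h
    have := Nat.count_le (p := p) (n := k)
    omega
  · intro h
    rw [← (Nat.count_iff_forall (p := p) (n := c)).2 (fun h' => h _)]
    exact Nat.count_monotone p hc

theorem den_seq (c d : Prog) (s : State) : (c ;; d).den s = d.den (c.den s) := rfl

namespace GameData

variable {D : GameData} {a b x y U W : ℕ}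

theorem Ok.anti {d k l : ℕ} (h : D.Ok a b x y U W d l) (hkl : k ≤ l) :
    D.Ok a b x y U W d k := by
  unfold Ok OkOne at *
  omega

/-- `Ok` is downward closed in the number of votes, so "at most as many votes as slots" says the
same as "a harmless number of votes". The case of no votes is a separate assumption because slots
only test `k + 1`. -/
theorem le_count_ok_iff {d : ℕ} (h0 : D.Ok a b x y U W d 0) {k : ℕ} (hk : k ≤ D.n) :
    k ≤ Nat.count (fun k => D.Ok a b x y U W d (k + 1)) D.n ↔ D.Ok a b x y U W d k := by
  rw [le_count_iff (fun i j hij h => h.anti (by omega)) hk]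
  constructor
  · intro h
    cases k with
    | zero => exact h0
    | succ k => exact h k (by omega)
  · exact fun h i hi => h.anti (by omega)

/-- For `d = x` the vote of voter 1 cancels and there is no tie to break, so `OkOne` reads `k ≤ U`.
Filling all slots of `x` thus means giving it exactly the guessed score. -/
theorem count_ok_left (h0 : D.Ok a b x y U W x 0) (hU : U ≤ D.n) (h : D.Ok a b x y U W x U) :
    Nat.count (fun k => D.Ok a b x y U W x (k + 1)) D.n = U := by
  refine le_antisymm ?_ ((le_count_ok_iff h0 hU).2 h)
  have := ((le_count_ok_iff h0 (Nat.count_le _)).1 le_rfl).1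
  simp only [OkOne, lt_irrefl, if_false] at this
  omega

theorem count_ok_right (h0 : D.Ok a b x y U W y 0) (hW : W ≤ D.n) (h : D.Ok a b x y U W y W) :
    Nat.count (fun k => D.Ok a b x y U W y (k + 1)) D.n = W := by
  refine le_antisymm ?_ ((le_count_ok_iff h0 hW).2 h)
  have := ((le_count_ok_iff h0 (Nat.count_le _)).1 le_rfl).2
  simp only [OkOne, lt_irrefl, if_false] at this
  omega

/-- Feasibility as a matching problem. -/
theorem feasible_iff (hn : 1 ≤ D.n) (hx : x < D.m) (hy : y < D.m) (hU : U ≤ D.n)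
    (hW : W ≤ D.n) {S : ℕ} {cand : ℕ → ℕ}
    (hcand : ∀ d, Nat.count (fun j => cand j = d) S =
      if d < D.m then Nat.count (fun k => D.Ok a b x y U W d (k + 1)) D.n else 0) :
    D.Feasible a b x y U W ↔
      ((D.Ok a b x y U W x U ∧ D.Ok a b x y U W y W ∧ D.pp x < D.pp y) ∧
        ∀ d < D.m, D.Ok a b x y U W d 0) ∧
      Auction.HasMatching (fun i j => (i < D.n ∧ cand j < D.m ∧ D.T i (cand j)) ∨
        (D.n ≤ i ∧ cand j ≠ x ∧ cand j ≠ y)) S (D.n + (S + 1 - D.n)) := by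
  rw [Auction.hasMatching_iff (fun i c => c < D.m ∧ D.T i c) cand x y hn rfl]
  have hlen : ∀ t d, Auction.voteCount D.n t d ≤ D.n := by
    intro t d
    refine (Finset.card_filter_le _ _).trans ?_
    simp
  constructor
  · rintro ⟨hpp, t, hT, htx, hty, hok⟩
    have h0 : ∀ d < D.m, D.Ok a b x y U W d 0 := fun d hd => (hok d hd).anti (Nat.zero_le _)
    have hxU := htx ▸ hok x hx
    have hyW := hty ▸ hok y hy
    refine ⟨⟨⟨hxU, hyW, hpp⟩, h0⟩, t, hT, ?_, ?_, fun d => ?_⟩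
    · rw [hcand, if_pos hx, count_ok_left (h0 x hx) hU hxU, htx]
    · rw [hcand, if_pos hy, count_ok_right (h0 y hy) hW hyW, hty]
    · rw [hcand]
      split_ifs with hd
      · exact (le_count_ok_iff (h0 d hd) (hlen _ _)).2 (hok d hd)
      -- A number `d ≥ m` is not a candidate: it has no slots, and no voter chooses it.
      · refine le_of_eq (Finset.card_eq_zero.2 (Finset.filter_eq_empty_iff.2 fun i hi h => hd ?_))
        rw [Finset.mem_Ico] at hi
        exact h ▸ (hT i hi.1 hi.2).1
  · rintro ⟨⟨⟨hxU, hyW, hpp⟩, h0⟩, t, hT, htx, hty, hle⟩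
    rw [hcand, if_pos hx, count_ok_left (h0 x hx) hU hxU] at htx
    rw [hcand, if_pos hy, count_ok_right (h0 y hy) hW hyW] at hty
    refine ⟨hpp, t, hT, htx, hty, fun d hd => ?_⟩
    have := hle d
    rw [hcand, if_pos hd] at this
    exact (le_count_ok_iff (h0 d hd) (hlen _ _)).1 this

end GameData

theorem checkPair_spec {D : GameData} {s : State} (h : Env D s)
    (hx : s.var rX < D.m) (hy : s.var rY < D.m) {ok : ℕ → ℕ → Prop}
    (hok : ok = D.Ok (s.var rA) (s.var rB) (s.var rX) (s.var rY) (s.var rU) (s.var rW)) :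
    (checkPair.den s).var rF ≤ 1 ∧
    ((checkPair.den s).var rF ≠ 0 ↔ ok (s.var rX) (s.var rU) ∧ ok (s.var rY) (s.var rW) ∧
      D.pp (s.var rX) < D.pp (s.var rY)) := by
  have h1 := eval_notOk_eq_zero h hx hy (d := .var rX) (k := .var rU) hx
  have h2 := eval_notOk_eq_zero h hx hy (d := .var rY) (k := .var rW) hy
  rw [← hok] at h1 h2
  simp only [eval_var] at h1 h2
  rw [← h1, ← h2, ← h.hpp _ hx, ← h.hpp _ hy]
  simp only [checkPair, den, State.setVar, Function.update_self, eval_sub, eval_add, eval_const,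
    eval_get, eval_var]
  omega

/-- The flag `rG` is set on success and never reset, so it accumulates a disjunction over the
guesses, in the form that `upto_or` needs. -/
theorem testPair_spec {D : GameData} {s : State} (h : Env D s)
    (hx : s.var rX < D.m) (hy : s.var rY < D.m) (hU : s.var rU ≤ D.n) (hW : s.var rW ≤ D.n) :
    (testPair.den s).var rG ≠ 0 ↔ s.var rG ≠ 0 ∨
      D.Feasible (s.var rA) (s.var rB) (s.var rX) (s.var rY) (s.var rU) (s.var rW) := by
  have hle := h.le_L
  obtain ⟨c1, c2⟩ := checkPair_spec h hx hy rfl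
  rw [testPair, den_seq, preparePair, den_seq, den_seq, den_seq]
  have hF1 : Frame preparePair s (checkPair.den s) := (Frame.refl _ _).den (by decide) (by decide)
  have hf := frame_den checkPair s
  generalize checkPair.den s = s1 at *
  have hE1 : Env D s1 := h.frame hF1 (by decide)
  have e : ∀ v, v ∉ checkPair.writes → s1.var v = s.var v := hf.1
  have hsl := makeSlots_spec hE1 (by rwa [e rX (by decide)]) (by rwa [e rY (by decide)]) rfl c1
  rw [e rA (by decide), e rB (by decide), e rX (by decide), e rY (by decide), e rU (by decide),
    e rW (by decide)] at hsl
  obtain ⟨hS, f1, f2⟩ := hsl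
  have hF2 : Frame preparePair s (makeSlots.den s1) := hF1.den (by decide) (by decide)
  generalize makeSlots.den s1 = s2 at *
  clear hf hE1 e
  have hE2 : Env D s2 := h.frame hF2 (by decide)
  have hF3 : Frame preparePair s ((Prog.assign rAgents
      (.var rN + (.var rS + .const 1 - .var rN))).den s2) := hF2.den (by decide) (by decide)
  have g1 : ((Prog.assign rAgents
      (.var rN + (.var rS + .const 1 - .var rN))).den s2).var rAgents =
      D.n + (s2.var rS + 1 - D.n) := by
    simp [den, State.setVar, eval_add, eval_sub, eval_var, eval_const, hE2.hn]
  have g2 : ((Prog.assign rAgents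
      (.var rN + (.var rS + .const 1 - .var rN))).den s2).arr aCand = s2.arr aCand := rfl
  have g3 : ((Prog.assign rAgents
      (.var rN + (.var rS + .const 1 - .var rN))).den s2).var rS = s2.var rS :=
    den_var _ _ (by decide)
  have g4 : ((Prog.assign rAgents
      (.var rN + (.var rS + .const 1 - .var rN))).den s2).var rF = s2.var rF :=
    den_var _ _ (by decide)
  generalize (Prog.assign rAgents (.var rN + (.var rS + .const 1 - .var rN))).den s2 = s3 at *
  have hE3 : Env D s3 := h.frame hF3 (by decide)
  have hSle := hS.le
  have hau := auction_spec (s := s3) (S := s2.var rS) (A := D.n + (s2.var rS + 1 - D.n))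
    (fun i j => (i < D.n ∧ s2.arr aCand j < D.m ∧ D.T i (s2.arr aCand j)) ∨
        (D.n ≤ i ∧ s2.arr aCand j ≠ s.var rX ∧ s2.arr aCand j ≠ s.var rY)) g3 g1
    (by have := h.one_le_n; omega) (by rw [hE3.hL]; omega) (by
      intro r hr hcur hj
      have hEr : Env D r := hE3.frame hr (by decide)
      have e1 : r.var rX = s.var rX := (hr.1 _ (by decide)).trans (hF3.1 _ (by decide))
      have e2 : r.var rY = s.var rY := (hr.1 _ (by decide)).trans (hF3.1 _ (by decide))
      have e3 : r.arr aCand = s2.arr aCand := (hr.2 _ (by decide)).trans g2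
      have hc := hS.cand_lt _ hj
      have := hEr.hT (r.var rCur) (by omega) _ hc
      simp only [adjE, eval_add, eval_sub, eval_get, eval_var, eval_const, eval_eqE, e1, e2, e3,
        hEr.hn, ne_eq, Nat.add_eq_zero_iff, not_and_or]
      rw [← ne_eq, this]
      refine or_congr (by simp [hc]) ?_
      split_ifs <;> simp_all <;> omega)
  have hF4 : Frame preparePair s (auction.den s3) := hF3.den (by decide) (by decide)
  have g5 : (auction.den s3).var rF = s2.var rF := (den_var _ _ (by decide)).trans g4
  have g6 : (auction.den s3).var rAgents = D.n + (s2.var rS + 1 - D.n) :=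
    (den_var _ _ (by decide)).trans g1
  have g7 : (auction.den s3).var rG = s.var rG := hF4.1 _ (by decide)
  rw [GameData.feasible_iff h.one_le_n hx hy hU hW hS.count_eq, ← hau, ← c2, ← f2]
  generalize auction.den s3 = s4 at *
  -- Since `rF ≤ 1`, this truncated difference is nonzero exactly if `rF = 1`, nobody is bidding and
  -- all agents have entered.
  have hev : (Expr.var rF - (.var rCur + (.const 1 - (Expr.var rNext).eqE (.var rAgents)))).eval s4
      = s2.var rF - (s4.var rCur +
        (1 - if s4.var rNext = D.n + (s2.var rS + 1 - D.n) then 1 else 0)) := by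
    simp only [eval_sub, eval_add, eval_var, eval_const, eval_eqE, g5, g6]
  rw [den, hev]
  split_ifs with h1 h2 h2 <;> simp [den, State.setVar, eval_const, g7] <;> omega

/-- A loop that looks for a number with the property `Q`. -/
theorem upto_or {x h g : ℕ} {e : Expr} {c : Prog} {s : State} {N : ℕ} (Q : ℕ → Prop)
    (hN : e.eval s = N) (hL : N ≤ s.var 1) (hgx : g ≠ x) (hgh : g ≠ h)
    (hc : ∀ r, r.var x < N → Frame (.upto x h e c) s r →
      ((c.den r).var g ≠ 0 ↔ r.var g ≠ 0 ∨ Q (r.var x))) :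
    ((Prog.upto x h e c).den s).var g ≠ 0 ↔ s.var g ≠ 0 ∨ ∃ k < N, Q k := by
  have key := upto_induction (x := x) (h := h) (e := e) (c := c) (s := s) (N := N) hN hL
    (fun k r => Frame (.upto x h e c) s r ∧ (r.var g ≠ 0 ↔ s.var g ≠ 0 ∨ ∃ k' < k, Q k'))
    ⟨((Frame.refl _ _).setVar _ (by simp [writes])).setVar _ (by simp [writes]),
      by simp [State.setVar, hgx, hgh]⟩ (by
    rintro k r hk hx ⟨hF, hI⟩
    refine ⟨(hF.den (d := c) (fun v hv => by simp [writes, hv]) (fun a ha => ha)).setVar _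
      (by simp [writes]), ?_⟩
    have := hc r (by omega) hF
    rw [hx, hI] at this
    simp only [State.setVar, Function.update_of_ne hgx]
    rw [this, Nat.exists_lt_succ_right, or_assoc])
  exact key.2

/-- Look for the candidates and scores of `Feasible`. -/
def search : Prog :=
  .assign rG (.const 0) ;;
  .upto rX 17 (.var rM) (.upto rY 19 (.var rM)
    (.upto rU 21 (.var rN) (.upto rW 23 (.var rN) testPair)))

/-- For some votes of the others, voter 1 is better off with `a` than with `b`. -/
def GameData.Better (D : GameData) (a b : ℕ) : Prop :=
  ∃ x < D.m, ∃ y < D.m, ∃ U < D.n, ∃ W < D.n, D.Feasible a b x y U W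

theorem search_spec {D : GameData} {s : State} (h : Env D s) :
    (search.den s).var rG ≠ 0 ↔ D.Better (s.var rA) (s.var rB) := by
  have hle := h.le_L
  rw [search, den]
  have hF0 : Frame search s ((Prog.assign rG (.const 0)).den s) :=
    (Frame.refl _ _).den (by decide) (by decide)
  have h0 : ((Prog.assign rG (.const 0)).den s).var rG = 0 := by simp [den, State.setVar, eval_const]
  generalize (Prog.assign rG (.const 0)).den s = s0 at *
  have hE0 : Env D s0 := h.frame hF0 (by decide)
  rw [upto_or (fun x => ∃ y < D.m, ∃ U < D.n, ∃ W < D.n,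
      D.Feasible (s.var rA) (s.var rB) x y U W)
      (show Expr.eval s0 (.var rM) = D.m from hE0.hm) (by rw [hE0.hL]; omega) (by decide)
      (by decide), h0]
  · simp [GameData.Better]
  intro r1 hx hF1
  have hF1' : Frame search s r1 := hF0.trans hF1 (by decide) (by decide)
  have hE1 : Env D r1 := h.frame hF1' (by decide)
  refine upto_or (fun y => ∃ U < D.n, ∃ W < D.n,
      D.Feasible (s.var rA) (s.var rB) (r1.var rX) y U W) hE1.hm (by rw [hE1.hL]; omega)
      (by decide) (by decide) fun r2 hy hF2 => ?_
  have hF2' : Frame search s r2 := hF1'.trans hF2 (by decide) (by decide)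
  have hE2 : Env D r2 := h.frame hF2' (by decide)
  have e2 : r2.var rX = r1.var rX := hF2.1 _ (by decide)
  refine upto_or (fun U => ∃ W < D.n,
      D.Feasible (s.var rA) (s.var rB) (r1.var rX) (r2.var rY) U W) hE2.hn
      (by rw [hE2.hL]; omega) (by decide) (by decide) fun r3 hU hF3 => ?_
  have hF3' : Frame search s r3 := hF2'.trans hF3 (by decide) (by decide)
  have hE3 : Env D r3 := h.frame hF3' (by decide)
  have e3 : r3.var rX = r2.var rX := hF3.1 _ (by decide)
  have e3' : r3.var rY = r2.var rY := hF3.1 _ (by decide)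
  refine upto_or (fun W => D.Feasible (s.var rA) (s.var rB) (r1.var rX) (r2.var rY) (r3.var rU) W)
      hE3.hn (by rw [hE3.hL]; omega) (by decide) (by decide) fun r4 hW hF4 => ?_
  have hF4' : Frame search s r4 := hF3'.trans hF4 (by decide) (by decide)
  have e4 : r4.var rX = r3.var rX := hF4.1 _ (by decide)
  have e4' : r4.var rY = r3.var rY := hF4.1 _ (by decide)
  have e4'' : r4.var rU = r3.var rU := hF4.1 _ (by decide)
  rw [testPair_spec (h.frame hF4' (by decide)) (by omega) (by omega) (by omega) (by omega),
    e4'', e4', e4, e3', e3, e2, hF4'.1 rA (by decide), hF4'.1 rB (by decide)]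

-- Weak dominance between two top candidates

notation "rC" => (11 : ℕ)
notation "rT" => (13 : ℕ)
notation "rGood" => (42 : ℕ)
notation "rRes" => (43 : ℕ)

/-- Set `rRes` to `1` if voting for `rC` weakly dominates voting for `rT`. -/
def compareVotes : Prog :=
  .assign rA (.var rC) ;; .assign rB (.var rT) ;; search ;; .assign rGood (.var rG) ;;
  .assign rA (.var rT) ;; .assign rB (.var rC) ;; search ;;
  .ite (.var rG) .skip (.ite (.var rGood) (.assign rRes (.const 1)) .skip)

/-- Look for a candidate `rC` that satisfies `guard` and for whom voting weakly dominates voting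
for `rT`. -/
def dominanceLoop (guard : Expr) : Prog :=
  .upto rC 12 (.var rM) (.ite guard compareVotes .skip)

theorem compareVotes_spec {D : GameData} {s : State} (h : Env D s) :
    (compareVotes.den s).var rRes ≠ 0 ↔ s.var rRes ≠ 0 ∨
      (D.Better (s.var rC) (s.var rT) ∧ ¬ D.Better (s.var rT) (s.var rC)) := by
  rw [compareVotes, den_seq, den_seq, den_seq, den_seq, den_seq, den_seq, den_seq]
  have hF1 : Frame compareVotes s
      ((Prog.assign rB (.var rT)).den ((Prog.assign rA (.var rC)).den s)) :=
    ((Frame.refl _ _).den (by decide) (by decide)).den (by decide) (by decide)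
  have a1 : ((Prog.assign rB (.var rT)).den ((Prog.assign rA (.var rC)).den s)).var rA =
    s.var rC := by simp [den, State.setVar, eval_var]
  have b1 : ((Prog.assign rB (.var rT)).den ((Prog.assign rA (.var rC)).den s)).var rB =
    s.var rT := by simp [den, State.setVar, eval_var]
  have c1 : ((Prog.assign rB (.var rT)).den ((Prog.assign rA (.var rC)).den s)).var rRes =
    s.var rRes := by simp [den, State.setVar, eval_var]
  generalize (Prog.assign rB (.var rT)).den ((Prog.assign rA (.var rC)).den s) = s1 at *
  have h1 := search_spec (h.frame hF1 (by decide))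
  rw [a1, b1] at h1
  have c2 : (search.den s1).var rRes = s.var rRes := (den_var _ _ (by decide)).trans c1
  have hF2 : Frame compareVotes s (search.den s1) := hF1.den (by decide) (by decide)
  generalize search.den s1 = s2 at *
  have hF3 : Frame compareVotes s ((Prog.assign rB (.var rC)).den ((Prog.assign rA (.var rT)).den
      ((Prog.assign rGood (.var rG)).den s2))) :=
    ((hF2.den (by decide) (by decide)).den (by decide) (by decide)).den (by decide) (by decide)
  have a3 : ((Prog.assign rB (.var rC)).den ((Prog.assign rA (.var rT)).den
      ((Prog.assign rGood (.var rG)).den s2))).var rA = s.var rT := by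
    rw [← hF2.1 rT (by decide)]
    simp [den, State.setVar, eval_var]
  have b3 : ((Prog.assign rB (.var rC)).den ((Prog.assign rA (.var rT)).den
      ((Prog.assign rGood (.var rG)).den s2))).var rB = s.var rC := by
    rw [← hF2.1 rC (by decide)]
    simp [den, State.setVar, eval_var]
  have c3 : ((Prog.assign rB (.var rC)).den ((Prog.assign rA (.var rT)).den
      ((Prog.assign rGood (.var rG)).den s2))).var rRes = s.var rRes := by
    simpa [den, State.setVar, eval_var] using c2
  have d3 : ((Prog.assign rB (.var rC)).den ((Prog.assign rA (.var rT)).den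
      ((Prog.assign rGood (.var rG)).den s2))).var rGood = s2.var rG := by
    simp [den, State.setVar, eval_var]
  generalize (Prog.assign rB (.var rC)).den ((Prog.assign rA (.var rT)).den
      ((Prog.assign rGood (.var rG)).den s2)) = s3 at *
  have h3 := search_spec (h.frame hF3 (by decide))
  rw [a3, b3] at h3
  have c4 : (search.den s3).var rRes = s.var rRes := (den_var _ _ (by decide)).trans c3
  have d4 : (search.den s3).var rGood = s2.var rG := (den_var _ _ (by decide)).trans d3
  generalize search.den s3 = s4 at *
  rw [← h1, ← h3]
  simp only [den, eval_var, d4]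
  by_cases e1 : s4.var rG = 0 <;> by_cases e2 : s2.var rG = 0 <;>
    simp [State.setVar, eval_const, e1, e2, c4]

notation "rVote" => (44 : ℕ)

theorem dominanceLoop_spec {D : GameData} {s : State} (h : Env D s) (guard : Expr)
    (G : ℕ → Prop) (hG : ∀ r : State, r.var rVote = s.var rVote →
      (guard.eval r ≠ 0 ↔ G (r.var rC))) :
    ((dominanceLoop guard).den s).var rRes ≠ 0 ↔ s.var rRes ≠ 0 ∨
      ∃ c < D.m, G c ∧ D.Better c (s.var rT) ∧ ¬ D.Better (s.var rT) c := by
  have hle := h.le_L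
  refine upto_or (fun c => G c ∧ D.Better c (s.var rT) ∧ ¬ D.Better (s.var rT) c) h.hm
    (by rw [h.hL]; omega) (by decide) (by decide) fun r hc hF => ?_
  -- The guard affects neither `writes` nor `stores`. Replacing it by a closed expression lets
  -- `decide` evaluate them.
  have hF' : Frame (dominanceLoop (.const 0)) s r := hF
  have hg := hG r (hF'.1 _ (by decide))
  rw [den]
  split_ifs with h0
  · have : ¬ G (r.var rC) := fun h => hg.2 h h0
    simp [den, this]
  · rw [compareVotes_spec (h.frame hF' (by decide)), hF'.1 rT (by decide)]
    have := hg.1 h0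
    tauto

end RAM

/-! ### Encodings and the data extracted from an instance -/

namespace Voting

theorem length_encodeVote {m : ℕ} (v : Vote m) : (encodeVote v).length = m := by
  simp [encodeVote]

theorem length_flatMap_encodeVote {m : ℕ} (l : List (Vote m)) :
    (l.flatMap encodeVote).length = l.length * m := by
  induction l with
  | nil => simp
  | cons v l ih => simp [ih, length_encodeVote, Nat.succ_mul, add_comm]

theorem length_le_length_flatMap_encodeVotes {m : ℕ} (l : List (List (Vote m))) :
    l.length ≤ (l.flatMap encodeVotes).length := by
  induction l with
  | nil => simp
  | cons v l ih =>
    simp [encodeVotes]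
    omega

theorem encodeVote_eq_cons {m : ℕ} [NeZero m] (v : Vote m) :
    ∃ l, encodeVote v = (v 0 : ℕ) :: l := by
  obtain ⟨k, rfl⟩ := Nat.exists_eq_succ_of_ne_zero (NeZero.ne m)
  exact ⟨_, by rw [encodeVote, List.ofFn_succ]⟩

theorem drop_encodeVote_append {m : ℕ} (v : Vote m) (l : List ℕ) :
    (encodeVote v ++ l).drop m = l :=
  List.drop_left' (length_encodeVote v)

/-- The candidates that voter `i` may rank first: his favourite and those of his strategies. -/
def Instance.Top (I : Instance) (i c : ℕ) : Prop :=
  ∃ hi : i < I.n, ∃ v ∈ I.V ⟨i, hi⟩ :: I.lists ⟨i, hi⟩, (v 0 : ℕ) = c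

/-- The position of a candidate in an order. -/
def position {m : ℕ} (v : Vote m) (c : ℕ) : ℕ := if h : c < m then v.symm ⟨c, h⟩ else 0

theorem position_apply {m : ℕ} (v : Vote m) (p : Fin m) : position v (v p) = p := by
  simp [position]

theorem position_val {m : ℕ} (v : Vote m) (c : Fin m) : position v c = v.symm c := by
  simp [position]

/-- What the decision procedures have to know about an instance. -/
def Instance.data (I : Instance) (L : ℕ) : RAM.GameData where
  m := I.m
  n := I.n
  L := L
  tp := position I.tie
  pp := position (I.V 0)
  T := I.Top

end Voting

/-! ### Reading the input -/

namespace RAM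

open Prog Voting

theorem getD_of_drop {l : List ℕ} {p c : ℕ} {t : List ℕ} (h : l.drop p = c :: t) :
    l.getD p 0 = c := by
  have : (l.drop p)[0]? = some c := by rw [h]; rfl
  rw [List.getElem?_drop, add_zero] at this
  simp [List.getD, this]

notation "rP" => (4 : ℕ)
notation "rZ" => (5 : ℕ)
notation "rI" => (6 : ℕ)
notation "rQ" => (8 : ℕ)
notation "rLen" => (10 : ℕ)

/-- Store the positions of the candidates in the order that the pointer `rP` points to. -/
def readOrder (a : ℕ) : Prog :=
  .upto rI 7 (.var rM) (.store a (.get 0 (.var rP + .var rI)) (.var rI))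

/-- Store the multiples of the number of candidates. -/
def makeBase : Prog :=
  .assign rZ (.const 0) ;;
  .upto rI 7 (.var 1) (.store aBase (.var rI) (.var rZ) ;; .assign rZ (.var rZ + .var rM))

/-- Register the favourite of voter `rI` in the vote that the pointer `rP` points to, and go to
the next vote. -/
def readVote : Prog :=
  .store aMem (.get aBase (.var rI) + .get 0 (.var rP)) (.const 1) ;;
  .assign rP (.var rP + .var rM)

/-- Read the sincere votes. -/
def readVotes : Prog := .upto rI 7 (.var rN) readVote

/-- Read a list of votes. -/
def readList : Prog :=
  .assign rLen (.get 0 (.var rP)) ;; .assign rP (.var rP + .const 1) ;;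
  .upto rQ 9 (.var rLen) readVote

/-- Read the lists of strategies. -/
def readLists : Prog := .upto rI 7 (.var rN) readList

/-- Read the input; at the end, the pointer `rP` points to what follows the instance. -/
def parse : Prog :=
  .assign rM (.get 0 (.const 0)) ;; .assign rN (.get 0 (.const 1)) ;; .assign rP (.const 2) ;;
  readOrder 1 ;; .assign rP (.var rP + .var rM) ;; readOrder 2 ;;
  makeBase ;; readVotes ;; readLists

/-- The state during the reading of `x`: the pointer `rP` points to `rest`, and `M` contains the
favourites that have been registered. -/
structure Reading (I : Instance) (x : List ℕ) (r : State) (rest : List ℕ) (M : ℕ → Prop) :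
    Prop where
  hL : r.var 1 = x.length
  hm : r.var rM = I.m
  hn : r.var rN = I.n
  input : ∀ i, r.arr 0 i = x.getD i 0
  base : ∀ i < x.length, r.arr aBase i = i * I.m
  drop : x.drop (r.var rP) = rest
  mem : ∀ j, r.arr aMem j ≠ 0 ↔ M j

variable {I : Instance} {x rest : List ℕ} {M M' : ℕ → Prop} {r : State}

theorem Reading.congr (h : Reading I x r rest M) (hM : ∀ j, M j ↔ M' j) :
    Reading I x r rest M' := by
  rwa [← show M = M' from funext fun j => propext (hM j)]

theorem Reading.setVar (h : Reading I x r rest M) {y : ℕ} (k : ℕ)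
    (hy : 1 ≠ y ∧ rM ≠ y ∧ rN ≠ y ∧ rP ≠ y) : Reading I x (r.setVar y k) rest M := by
  obtain ⟨h1, h2, h3, h4⟩ := hy
  exact ⟨by simpa [State.setVar, h1] using h.hL, by simpa [State.setVar, h2] using h.hm,
    by simpa [State.setVar, h3] using h.hn, h.input, h.base,
    by simpa [State.setVar, h4] using h.drop, h.mem⟩

theorem readVote_spec {v : Vote I.m} (h : Reading I x r (encodeVote v ++ rest) M)
    (hi : r.var rI < x.length) :
    Reading I x (readVote.den r) rest (fun j => M j ∨ j = r.var rI * I.m + v 0) := by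
  obtain ⟨t, ht⟩ := encodeVote_eq_cons v
  have hd := h.drop
  have h0 := getD_of_drop (hd.trans (by rw [ht, List.cons_append]))
  refine ⟨by simpa [readVote, den, State.setVar, State.setArr] using h.hL,
    by simpa [readVote, den, State.setVar, State.setArr] using h.hm,
    by simpa [readVote, den, State.setVar, State.setArr] using h.hn,
    by simpa [readVote, den, State.setVar, State.setArr] using h.input,
    by simpa [readVote, den, State.setVar, State.setArr] using h.base, ?_, fun j => ?_⟩
  · simp only [readVote, den, State.setVar, State.setArr, Function.update_self, eval_add,
      eval_var, h.hm]
    rw [← List.drop_drop, hd, drop_encodeVote_append]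
  · simp only [readVote, den, State.setVar, State.setArr, Function.update_self, eval_add,
      eval_var, eval_get, h.input, h0, h.base _ hi, eval_const, Function.update_apply]
    split_ifs with hj
    · simp [hj]
    · simp [hj, h.mem j]

theorem readVotes_spec (hn : I.n ≤ x.length)
    (h : Reading I x r ((List.ofFn I.V).flatMap encodeVote ++ rest) M) :
    Reading I x (readVotes.den r) rest
      (fun j => M j ∨ ∃ i : Fin I.n, j = i * I.m + I.V i 0) := by
  have := upto_induction (x := rI) (h := 7) (e := .var rN) (s := r) (N := I.n) (c := readVote)
    h.hn (by rwa [h.hL])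
    (fun k q => Reading I x q (((List.ofFn I.V).drop k).flatMap encodeVote ++ rest)
      (fun j => M j ∨ ∃ i : Fin I.n, i.1 < k ∧ j = i * I.m + I.V i 0))
    (((h.congr (by simp)).setVar _ (by decide)).setVar _ (by decide)) (by
    intro k q hk hq h
    rw [List.drop_eq_getElem_cons (by simpa using hk), List.flatMap_cons, List.append_assoc,
      List.getElem_ofFn] at h
    refine ((readVote_spec h (by omega)).congr fun j => ?_).setVar _ (by decide)
    rw [or_assoc, hq]
    refine or_congr_right ⟨?_, ?_⟩
    · rintro (⟨i, hi, rfl⟩ | rfl)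
      · exact ⟨i, by omega, rfl⟩
      · exact ⟨⟨k, hk⟩, by simp, rfl⟩
    · rintro ⟨i, hi, rfl⟩
      rcases Nat.lt_succ_iff_lt_or_eq.1 hi with hi | rfl
      · exact .inl ⟨i, hi, rfl⟩
      · exact .inr rfl)
  rw [readVotes]
  rw [List.drop_eq_nil_of_le (by simp)] at this
  exact this.congr (by simp)

theorem readList_spec {l : List (Vote I.m)} (hi : r.var rI < x.length)
    (h : Reading I x r (encodeVotes l ++ rest) M) :
    Reading I x (readList.den r) rest
      (fun j => M j ∨ ∃ v ∈ l, j = r.var rI * I.m + v 0) := by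
  -- Every vote occupies `m ≥ 1` cells of the input, so the loop over the list stays within the cap.
  have hlen : l.length ≤ x.length := by
    have h1 := congrArg List.length h.drop
    have h2 := Nat.le_mul_of_pos_right l.length (Nat.pos_of_neZero I.m)
    simp only [encodeVotes, List.length_drop, List.length_append, List.length_cons,
      length_flatMap_encodeVote] at h1
    omega
  have h0 := getD_of_drop (h.drop.trans (by rw [encodeVotes, List.cons_append]))
  rw [readList, den_seq, den_seq]
  have h1 : Reading I x ((Prog.assign rP (.var rP + .const 1)).den
      ((Prog.assign rLen (.get 0 (.var rP))).den r)) (l.flatMap encodeVote ++ rest) M := by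
    refine ⟨by simpa [den, State.setVar] using h.hL, by simpa [den, State.setVar] using h.hm,
      by simpa [den, State.setVar] using h.hn, h.input, h.base, ?_, h.mem⟩
    have : ((Prog.assign rP (.var rP + .const 1)).den
      ((Prog.assign rLen (.get 0 (.var rP))).den r)).var rP = r.var rP + 1 := by
      simp [den, State.setVar, eval_add, eval_var, eval_const]
    rw [this, ← List.drop_drop, h.drop]
    simp [encodeVotes]
  have h2 : ((Prog.assign rP (.var rP + .const 1)).den
      ((Prog.assign rLen (.get 0 (.var rP))).den r)).var rLen = l.length := by
    simpa [den, State.setVar, eval_var, eval_get, h.input] using h0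
  have h3 : ((Prog.assign rP (.var rP + .const 1)).den
      ((Prog.assign rLen (.get 0 (.var rP))).den r)).var rI = r.var rI := by
    simp [den, State.setVar]
  generalize (Prog.assign rP (.var rP + .const 1)).den
      ((Prog.assign rLen (.get 0 (.var rP))).den r) = q0 at *
  have := upto_induction (x := rQ) (h := 9) (e := .var rLen) (s := q0) (N := l.length)
    (c := readVote) h2 (by rwa [h1.hL])
    (fun k q => q.var rI = r.var rI ∧ Reading I x q ((l.drop k).flatMap encodeVote ++ rest)
      (fun j => M j ∨ ∃ v ∈ l.take k, j = r.var rI * I.m + v 0))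
    ⟨by simpa [State.setVar] using h3,
      ((h1.congr (by simp)).setVar _ (by decide)).setVar _ (by decide)⟩ (by
    rintro k q hk - ⟨hq, h⟩
    rw [List.drop_eq_getElem_cons hk, List.flatMap_cons, List.append_assoc] at h
    refine ⟨by simpa [State.setVar, readVote, den, State.setArr] using hq,
      ((readVote_spec h (by omega)).congr fun j => ?_).setVar _ (by decide)⟩
    rw [or_assoc, hq, ← List.take_append_getElem hk]
    simp only [List.mem_append, List.mem_singleton, or_and_right, exists_or, exists_eq_left])
  obtain ⟨-, h4⟩ := this
  rw [List.drop_eq_nil_of_le le_rfl, List.take_of_length_le le_rfl] at h4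
  exact h4

theorem readLists_spec (hn : I.n ≤ x.length)
    (h : Reading I x r ((List.ofFn I.lists).flatMap encodeVotes ++ rest) M) :
    Reading I x (readLists.den r) rest
      (fun j => M j ∨ ∃ i : Fin I.n, ∃ v ∈ I.lists i, j = i * I.m + v 0) := by
  have := upto_induction (x := rI) (h := 7) (e := .var rN) (s := r) (N := I.n) (c := readList)
    h.hn (by rwa [h.hL])
    (fun k q => Reading I x q (((List.ofFn I.lists).drop k).flatMap encodeVotes ++ rest)
      (fun j => M j ∨ ∃ i : Fin I.n, i.1 < k ∧ ∃ v ∈ I.lists i, j = i * I.m + v 0))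
    (((h.congr (by simp)).setVar _ (by decide)).setVar _ (by decide)) (by
    intro k q hk hq h
    rw [List.drop_eq_getElem_cons (by simpa using hk), List.flatMap_cons, List.append_assoc,
      List.getElem_ofFn] at h
    refine ((readList_spec (by omega) h).congr fun j => ?_).setVar _ (by decide)
    rw [or_assoc, hq]
    refine or_congr_right ⟨?_, ?_⟩
    · rintro (⟨i, hi, hv⟩ | hv)
      · exact ⟨i, by omega, hv⟩
      · exact ⟨⟨k, hk⟩, by simp, hv⟩
    · rintro ⟨i, hi, hv⟩
      rcases Nat.lt_succ_iff_lt_or_eq.1 hi with hi | rfl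
      · exact .inl ⟨i, hi, hv⟩
      · exact .inr hv)
  rw [readLists]
  rw [List.drop_eq_nil_of_le (by simp)] at this
  exact this.congr (by simp)

/-- The machine cannot multiply, so the row addresses `i * m` come from repeated addition. The table
extends to `L` because dummies, numbered from `n` on, look up their (empty) rows as well. -/
theorem makeBase_spec {m L : ℕ} (hL : r.var 1 = L) (hm : r.var rM = m) :
    ∀ i < L, (makeBase.den r).arr aBase i = i * m := by
  have := upto_induction (x := rI) (h := 7) (e := .var 1)
    (s := (Prog.assign rZ (.const 0)).den r) (N := L)
    (c := .store aBase (.var rI) (.var rZ) ;; .assign rZ (.var rZ + .var rM))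
    (by simpa [den, State.setVar, eval_var] using hL)
    (le_of_eq (by simpa [den, State.setVar, eval_var] using hL.symm))
    (fun k q => q.var rM = m ∧ q.var rZ = k * m ∧ ∀ i < k, q.arr aBase i = i * m)
    ⟨by simpa [den, State.setVar] using hm, by simp [den, State.setVar, eval_const], by simp⟩ (by
    rintro k q hk hq ⟨h1, h2, h3⟩
    refine ⟨by simpa [den, State.setVar, State.setArr] using h1, ?_, fun i hi => ?_⟩
    · simp [den, State.setVar, State.setArr, eval_add, eval_var, h1, h2, Nat.succ_mul]
    · rcases Nat.lt_succ_iff_lt_or_eq.1 hi with hi | rfl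
      · simp [den, State.setVar, State.setArr, eval_var, hq, hi.ne, h3 i hi]
      · simp [den, State.setVar, State.setArr, eval_var, hq, h2])
  exact this.2.2

/-- Writing `p` into cell `v p` inverts the permutation; injectivity of `v` protects earlier
entries. -/
theorem readOrder_spec {m : ℕ} (v : Vote m) {a : ℕ} (ha : a ≠ 0) (hL : m ≤ r.var 1)
    (hm : r.var rM = m)
    (hv : ∀ p : Fin m, r.arr 0 (r.var rP + p) = v p) :
    ∀ d < m, ((readOrder a).den r).arr a d = position v d := by
  have := upto_induction (x := rI) (h := 7) (e := .var rM) (s := r) (N := m)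
    (c := .store a (.get 0 (.var rP + .var rI)) (.var rI)) hm hL
    (fun k q => q.var rP = r.var rP ∧ q.arr 0 = r.arr 0 ∧
      ∀ p : Fin m, p.1 < k → q.arr a (v p) = p)
    ⟨by simp [State.setVar], rfl, by simp⟩ (by
    rintro k q hk hq ⟨h1, h2, h3⟩
    refine ⟨by simpa [den, State.setVar, State.setArr] using h1, ?_, fun p hp => ?_⟩
    · simpa [den, State.setVar, State.setArr, ha.symm] using h2
    · simp only [den, State.setVar, State.setArr, eval_get, eval_add, eval_var, h1, h2, hq,
        Function.update_self]
      rw [show r.arr 0 (r.var rP + k) = v ⟨k, hk⟩ from hv ⟨k, hk⟩]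
      rcases Nat.lt_succ_iff_lt_or_eq.1 hp with hp | rfl
      · rw [Function.update_of_ne, h3 p hp]
        intro h
        have := congrArg Fin.val (v.injective (Fin.ext h))
        simp only at this
        omega
      · simp)
  intro d hd
  obtain ⟨p, hp⟩ := v.surjective ⟨d, hd⟩
  have h1 := this.2.2 p p.2
  rw [hp] at h1
  rw [readOrder, h1, show d = v p by rw [hp], position_apply]

end RAM

namespace RAM

open Prog Voting

theorem getD_of_drop_encodeVote {m : ℕ} {v : Vote m} {l t : List ℕ} {p : ℕ}
    (h : l.drop p = encodeVote v ++ t) (q : Fin m) : l.getD (p + q) 0 = v q := by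
  have h1 : (l.drop p)[q.1]? = some (v q : ℕ) := by
    rw [h, List.getElem?_append_left (by rw [length_encodeVote]; exact q.2)]
    simp [encodeVote]
  rw [List.getElem?_drop] at h1
  simp [List.getD, h1]

theorem mul_add_injective {m i j c d : ℕ} (hc : c < m) (hd : d < m)
    (h : i * m + c = j * m + d) : i = j ∧ c = d := by
  have h1 : i = j := by
    have := congrArg (· / m) h
    simpa [Nat.mul_add_div (show 0 < m by omega), mul_comm _ m, Nat.div_eq_of_lt hc,
      Nat.div_eq_of_lt hd] using this
  subst h1
  exact ⟨rfl, by omega⟩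

theorem parse_spec (I : Instance) {x tail : List ℕ} (hx : x = I.encode ++ tail) {s : State}
    (hL : s.var 1 = x.length) (hin : ∀ i, s.arr 0 i = x.getD i 0)
    (hmem : ∀ j, s.arr aMem j = 0) :
    Env (I.data x.length) (parse.den s) ∧ x.drop ((parse.den s).var rP) = tail := by
  have hx' : x = I.m :: I.n :: (encodeVote I.tie ++ ((List.ofFn I.V).flatMap encodeVote ++
      ((List.ofFn I.lists).flatMap encodeVotes ++ tail))) := by
    simp [hx, Instance.encode]
  -- Two header cells, `m` for the tie-breaking order, `m * n` for the sincere votes, and at least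
  -- one, the length, for each of the `n` lists. This makes the cap large enough for all loops, as
  -- there are at most `m * n` slots.
  have hlen : I.m * I.n + I.m + I.n + 2 ≤ x.length := by
    have := length_le_length_flatMap_encodeVotes (List.ofFn I.lists)
    rw [List.length_ofFn] at this
    simp only [hx', List.length_cons, List.length_append, length_encodeVote,
      length_flatMap_encodeVote, List.length_ofFn, mul_comm I.n]
    omega
  have d2 : x.drop 2 = encodeVote I.tie ++ ((List.ofFn I.V).flatMap encodeVote ++
      ((List.ofFn I.lists).flatMap encodeVotes ++ tail)) := by simp [hx']
  have d3 : x.drop (2 + I.m) = (List.ofFn I.V).flatMap encodeVote ++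
      ((List.ofFn I.lists).flatMap encodeVotes ++ tail) := by
    rw [← List.drop_drop, d2, drop_encodeVote_append]
  have hV0 : ∃ t, x.drop (2 + I.m) = encodeVote (I.V 0) ++ t := by
    have h0 : 0 < (List.ofFn I.V).length := by simpa using Nat.pos_of_neZero I.n
    rw [d3, ← List.drop_zero (l := List.ofFn I.V), List.drop_eq_getElem_cons h0,
      List.flatMap_cons, List.append_assoc, List.getElem_ofFn]
    exact ⟨_, rfl⟩
  rw [parse, den_seq, den_seq, den_seq, den_seq, den_seq, den_seq]
  -- the numbers of candidates and voters
  have a1 : ((Prog.assign rP (.const 2)).den ((Prog.assign rN (.get 0 (.const 1))).den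
      ((Prog.assign rM (.get 0 (.const 0))).den s))).var 1 = x.length := by
    simpa [den, State.setVar] using hL
  have a2 : ((Prog.assign rP (.const 2)).den ((Prog.assign rN (.get 0 (.const 1))).den
      ((Prog.assign rM (.get 0 (.const 0))).den s))).var rM = I.m := by
    simp [den, State.setVar, eval_get, eval_const, hin, hx']
  have a3 : ((Prog.assign rP (.const 2)).den ((Prog.assign rN (.get 0 (.const 1))).den
      ((Prog.assign rM (.get 0 (.const 0))).den s))).var rN = I.n := by
    simp [den, State.setVar, eval_get, eval_const, hin, hx']
  have a4 : ((Prog.assign rP (.const 2)).den ((Prog.assign rN (.get 0 (.const 1))).den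
      ((Prog.assign rM (.get 0 (.const 0))).den s))).var rP = 2 := by
    simp [den, State.setVar, eval_const]
  have a5 : ((Prog.assign rP (.const 2)).den ((Prog.assign rN (.get 0 (.const 1))).den
      ((Prog.assign rM (.get 0 (.const 0))).den s))).arr = s.arr := rfl
  generalize (Prog.assign rP (.const 2)).den ((Prog.assign rN (.get 0 (.const 1))).den
      ((Prog.assign rM (.get 0 (.const 0))).den s)) = s1 at *
  -- the tie-breaking order
  have htp := readOrder_spec (r := s1) I.tie (a := 1) (by decide) (by rw [a1]; omega) a2
    (fun p => by rw [a5, hin, a4, getD_of_drop_encodeVote d2])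
  have hf := frame_den (readOrder 1) s1
  generalize (readOrder 1).den s1 = s2 at *
  have b1 : ((Prog.assign rP (.var rP + .var rM)).den s2).var 1 = x.length := by
    rw [← a1, ← hf.1 1 (by decide)]
    simp [den, State.setVar]
  have b2 : ((Prog.assign rP (.var rP + .var rM)).den s2).var rM = I.m := by
    rw [← a2, ← hf.1 rM (by decide)]
    simp [den, State.setVar]
  have b3 : ((Prog.assign rP (.var rP + .var rM)).den s2).var rN = I.n := by
    rw [← a3, ← hf.1 rN (by decide)]
    simp [den, State.setVar]
  have b4 : ((Prog.assign rP (.var rP + .var rM)).den s2).var rP = 2 + I.m := by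
    simp [den, State.setVar, eval_add, eval_var, hf.1 rP (by decide), hf.1 rM (by decide), a4, a2]
  have b5 : ∀ a, a ≠ 1 → ((Prog.assign rP (.var rP + .var rM)).den s2).arr a = s.arr a := by
    intro a ha
    rw [← a5, ← hf.2 a (by simpa [readOrder, stores] using ha)]
    rfl
  have b6 : ((Prog.assign rP (.var rP + .var rM)).den s2).arr 1 = s2.arr 1 := rfl
  generalize (Prog.assign rP (.var rP + .var rM)).den s2 = s3 at *
  -- the preferences of voter 1
  obtain ⟨t, ht⟩ := hV0
  have hpp := readOrder_spec (r := s3) (I.V 0) (a := 2) (by decide) (by rw [b1]; omega) b2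
    (fun p => by rw [b5 _ (by decide), hin, b4, getD_of_drop_encodeVote ht])
  have hf' := frame_den (readOrder 2) s3
  generalize (readOrder 2).den s3 = s4 at *
  have hbase := makeBase_spec ((hf'.1 1 (by decide)).trans b1) ((hf'.1 rM (by decide)).trans b2)
  have hfin := frame_den (makeBase ;; readVotes ;; readLists) s4
  rw [den_seq, den_seq] at *
  have hR : Reading I x (makeBase.den s4) ((List.ofFn I.V).flatMap encodeVote ++
      ((List.ofFn I.lists).flatMap encodeVotes ++ tail)) (fun _ => False) := by
    refine ⟨?_, ?_, ?_, ?_, hbase, ?_, ?_⟩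
    · rw [den_var _ _ (by decide), hf'.1 1 (by decide), b1]
    · rw [den_var _ _ (by decide), hf'.1 rM (by decide), b2]
    · rw [den_var _ _ (by decide), hf'.1 rN (by decide), b3]
    · rw [den_arr _ _ (by decide), hf'.2 0 (by decide), b5 0 (by decide)]
      exact hin
    · rw [den_var _ _ (by decide), hf'.1 rP (by decide), b4, d3]
    · rw [den_arr _ _ (by decide), hf'.2 aMem (by decide), b5 aMem (by decide)]
      simpa using hmem
  have hR' := readLists_spec (by omega) (readVotes_spec (by omega) hR)
  generalize readLists.den (readVotes.den (makeBase.den s4)) = q at *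
  refine ⟨⟨hR'.hL, hR'.hm, hR'.hn, NeZero.one_le (n := I.n), hlen, ?_, ?_, ?_⟩, hR'.drop⟩
  · rw [hfin.2 1 (by decide), hf'.2 1 (by decide), b6]
    exact htp
  · rw [hfin.2 2 (by decide)]
    exact hpp
  · intro i hi d hd
    -- The rows of the table do not overlap (`mul_add_injective`), so the marks in row `i` are those
    -- of voter `i`, and there are none for `i ≥ n`.
    rw [hR'.base i hi, hR'.mem, false_or]
    constructor
    · rintro (⟨j, hj⟩ | ⟨j, v, hv, hj⟩)
      · obtain ⟨rfl, rfl⟩ := mul_add_injective hd (Fin.is_lt _) hj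
        exact ⟨j.2, j.2, _, List.mem_cons_self, rfl⟩
      · obtain ⟨rfl, rfl⟩ := mul_add_injective hd (Fin.is_lt _) hj
        exact ⟨j.2, j.2, v, List.mem_cons_of_mem _ hv, rfl⟩
    · rintro ⟨-, hi', v, hv, rfl⟩
      rcases List.mem_cons.1 hv with rfl | hv
      · exact .inl ⟨⟨i, hi'⟩, rfl⟩
      · exact .inr ⟨⟨i, hi'⟩, v, hv, rfl⟩

end RAM

/-! ### Plurality and GS-games in terms of first places -/

namespace Voting

theorem mem_topK_one {m : ℕ} [NeZero m] (v : Vote m) (c : Fin m) : c ∈ topK v 1 ↔ v 0 = c := by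
  rw [topK, Finset.mem_filter, Nat.lt_one_iff, ← Fin.val_zero m, Fin.val_inj,
    Equiv.symm_apply_eq]
  simp [eq_comm]

theorem score_one {m n : ℕ} [NeZero m] [NeZero n] (P : Profile m n) {t : ℕ → ℕ}
    (ht : ∀ i : Fin n, i ≠ 0 → t i = P i 0) (d : Fin m) :
    score 1 P d = Auction.voteCount n t d + if (d : ℕ) = P 0 0 then 1 else 0 := by
  obtain ⟨k, rfl⟩ := Nat.exists_eq_succ_of_ne_zero (NeZero.ne n)
  simp only [score, mem_topK_one, Auction.voteCount, Finset.card_filter]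
  rw [Fin.sum_univ_succ, Finset.sum_Ico_eq_sum_range, add_comm]
  congr 1
  · rw [Nat.succ_sub_one, ← Fin.sum_univ_eq_sum_range (fun i => if t (1 + i) = d then 1 else 0)]
    refine Finset.sum_congr rfl fun i _ => ?_
    have := ht i.succ (Fin.succ_ne_zero i)
    rw [Fin.val_succ, add_comm] at this
    simp [this, Fin.ext_iff]
  · simp [Fin.ext_iff, eq_comm]

/-- Scores are integers, so a rival that wins ties against `w` has to be strictly behind, that is,
behind by at least one point. -/
theorem plurality_eq_iff {m n : ℕ} [NeZero m] (tie : Vote m) (P : Profile m n) (w : Fin m) :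
    plurality tie P = w ↔
      ∀ d, score 1 P d + (if tie.symm d < tie.symm w then 1 else 0) ≤ score 1 P w := by
  obtain ⟨p, hp⟩ : ∃ p, (winningPositions tie 1 P).min' (winningPositions_nonempty tie 1 P) = p :=
    ⟨_, rfl⟩
  have hmem : ∀ d, score 1 P d ≤ score 1 P (tie p) := by
    have := Finset.min'_mem _ (winningPositions_nonempty tie 1 P)
    rw [hp] at this
    exact (Finset.mem_filter.1 this).2
  have hmin : ∀ q, (∀ d, score 1 P d ≤ score 1 P (tie q)) → p ≤ q := fun q hq =>
    hp ▸ Finset.min'_le _ _ (Finset.mem_filter.2 ⟨Finset.mem_univ _, hq⟩)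
  rw [plurality, kApproval, ← Equiv.eq_symm_apply, hp]
  clear hp
  constructor
  · intro hp d
    rw [hp, Equiv.apply_symm_apply] at hmem
    have h1 := hmem d
    split_ifs with hd
    · by_contra! hlt
      have := hmin (tie.symm d) fun e => by
        rw [Equiv.apply_symm_apply]
        have := hmem e
        omega
      rw [hp] at this
      exact absurd hd this.not_gt
    · exact h1
  · intro h
    refine le_antisymm (hmin _ fun d => ?_) (not_lt.1 fun hlt => ?_)
    · rw [Equiv.apply_symm_apply]
      exact (Nat.le_add_right _ _).trans (h d)
    · have h1 := h (tie p)
      rw [Equiv.symm_apply_apply, if_pos hlt] at h1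
      have := hmem w
      omega

theorem plurality_eq_iff_okOne (I : Instance) (L : ℕ) (P : Profile I.m I.n) {t : ℕ → ℕ}
    (ht : ∀ i : Fin I.n, i ≠ 0 → t i = P i 0) (x : Fin I.m) :
    plurality I.tie P = x ↔ ∀ d < I.m, (I.data L).OkOne (P 0 0) x
      (Auction.voteCount I.n t x) d (Auction.voteCount I.n t d) := by
  rw [plurality_eq_iff, Fin.forall_iff]
  refine forall_congr' fun d => forall_congr' fun hd => ?_
  rw [score_one P ht, score_one P ht, RAM.GameData.OkOne]
  have h1 : (I.data L).tp d = I.tie.symm ⟨d, hd⟩ := position_val I.tie ⟨d, hd⟩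
  have h2 : (I.data L).tp x = I.tie.symm x := position_val I.tie x
  rw [h1, h2]
  rfl

namespace GSGame

variable {m n : ℕ} [NeZero n] {R : VotingRule m n} {V : Profile m n}

/-- The decidability instance is arbitrary so that rewriting also matches the classical one in
`WeaklyDominates`. -/
theorem outcomeProfile_update (G : GSGame R V) [DecidableEq {i : Fin n // IsPlayer R V i}]
    (s : ∀ i : {i : Fin n // IsPlayer R V i}, {v : Vote m // v ∈ G.A i}) (u : Vote m) :
    G.outcomeProfile (Function.update s G.playerOne (G.strategyOne u)) =
      Function.update (G.outcomeProfile s) 0 u := by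
  funext i
  by_cases hi : i = 0
  · subst hi
    rw [Function.update_self, outcomeProfile,
      dif_pos (show IsPlayer R V 0 from Or.inl rfl)]
    exact congrArg Subtype.val (Function.update_self G.playerOne (G.strategyOne u) s)
  · rw [Function.update_of_ne hi, outcomeProfile, outcomeProfile]
    split_ifs with h
    · rw [Function.update_of_ne]
      exact fun e => hi (congrArg Subtype.val e)
    · rfl

/-- For some strategies of the other players, voter 1 prefers the outcome of `u` to that of
`v`. -/
def Better (G : GSGame R V) (u v : Vote m) : Prop :=
  ∃ s : ∀ i : {i : Fin n // IsPlayer R V i}, {v : Vote m // v ∈ G.A i},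
    Prefers (V 0) (R (Function.update (G.outcomeProfile s) 0 u))
      (R (Function.update (G.outcomeProfile s) 0 v))

/-- Preferences are linear, so weak preference is the negation of the reverse strict one, and "never
worse" becomes "the other strategy is never better". -/
theorem weaklyDominates_iff (G : GSGame R V) (u v : Vote m) :
    G.toNormalForm.WeaklyDominates G.playerOne (G.strategyOne u) (G.strategyOne v) ↔
      G.Better u v ∧ ¬ G.Better v u := by
  have key : ∀ a b : Fin m, (Prefers (V 0) a b ∨ a = b) ↔ ¬ Prefers (V 0) b a := by
    intro a b
    simp only [Prefers, not_lt, ← (V 0).symm.injective.eq_iff (a := a)]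
    exact le_iff_lt_or_eq.symm
  simp only [NormalFormGame.WeaklyDominates, NormalFormGame.StrictPref, outcomeProfile_update,
    key, not_not]
  rw [and_comm]
  refine and_congr (exists_congr fun s => ?_) not_exists.symm
  refine ⟨fun h => h.2, fun h => ⟨?_, h⟩⟩
  simp only [Prefers, not_lt] at h ⊢
  exact h.le

end GSGame

theorem Instance.mem_cons_lists (I : Instance) {i : Fin I.n}
    (s : ∀ i : {i : Fin I.n // IsPlayer (plurality I.tie) I.V i}, {v : Vote I.m // v ∈ I.game.A i})
    (hi : i ≠ 0) : I.game.outcomeProfile s i ∈ I.V i :: I.lists i := by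
  rw [GSGame.outcomeProfile]
  split_ifs with h
  · exact List.mem_cons_of_mem _ ((I.mem_lists _ _).2 ⟨hi, h, (s ⟨i, h⟩).2⟩)
  · exact List.mem_cons_self

/-- Converse of `Instance.mem_cons_lists`: the voters other than voter 1 choose independently from
`I.V i :: I.lists i`. For players this list is `A i`, which contains the sincere vote; for
non-players it is the sincere vote alone. -/
theorem Instance.exists_outcomeProfile_eq (I : Instance) {P : Profile I.m I.n}
    (hP : ∀ i, i ≠ 0 → P i ∈ I.V i :: I.lists i) :
    ∃ s : ∀ i : {i : Fin I.n // IsPlayer (plurality I.tie) I.V i}, {v : Vote I.m // v ∈ I.game.A i},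
      ∀ i, i ≠ 0 → I.game.outcomeProfile s i = P i := by
  have hmem : ∀ i : {i : Fin I.n // IsPlayer (plurality I.tie) I.V i}, P i ∈ I.game.A i := by
    rintro ⟨i, hi⟩
    by_cases h0 : i = 0
    · subst h0
      exact (Set.ext_iff.mp I.game.A_one _).mpr (Set.mem_univ _)
    · rcases List.mem_cons.1 (hP i h0) with h | h
      · rw [h]
        exact I.game.sincere_mem ⟨i, hi⟩
      · obtain ⟨-, h1, h2⟩ := (I.mem_lists _ _).1 h
        exact h2
  refine ⟨fun i => ⟨P i, hmem i⟩, fun i h0 => ?_⟩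
  rw [GSGame.outcomeProfile]
  split_ifs with h
  · rfl
  · rcases List.mem_cons.1 (hP i h0) with h' | h'
    · exact h'.symm
    · obtain ⟨-, h1, -⟩ := (I.mem_lists _ _).1 h'
      exact (h h1).elim

/-- From a strategy profile, read off the tops, the two winners and their scores, which are below
`n` because only `n - 1` other voters contribute. Conversely, give each other voter an allowed vote
with the required top; these choices are independent, so they form a strategy profile. -/
theorem Instance.better_iff (I : Instance) (L : ℕ) (u v : Vote I.m) :
    I.game.Better u v ↔ (I.data L).Better (u 0) (v 0) := by
  have hcount : ∀ (t : ℕ → ℕ) (d : ℕ), Auction.voteCount I.n t d < I.n := by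
    intro t d
    refine (Finset.card_filter_le _ _).trans_lt ?_
    have := NeZero.one_le (n := I.n)
    rw [Nat.card_Ico]
    omega
  have hpref : ∀ x y : Fin I.m, (I.data L).pp x < (I.data L).pp y ↔ Prefers (I.V 0) x y := by
    intro x y
    change position (I.V 0) x < position (I.V 0) y ↔ _
    rw [position_val, position_val]
    rfl
  constructor
  · rintro ⟨s, hs⟩
    set Q := I.game.outcomeProfile s with hQ
    let t : ℕ → ℕ := fun i => if h : i < I.n then Q ⟨i, h⟩ 0 else 0
    have ht : ∀ w : Vote I.m, ∀ i : Fin I.n, i ≠ 0 → t i = Function.update Q 0 w i 0 := by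
      intro w i hi
      simp [t, hi]
    refine ⟨_, Fin.is_lt _, _, Fin.is_lt _, _, hcount t _, _, hcount t _, (hpref _ _).2 hs, t, ?_,
      rfl, rfl, ?_⟩
    · intro i h1 h2
      have h0 : (⟨i, h2⟩ : Fin I.n) ≠ 0 := by
        intro h
        have := congrArg Fin.val h
        simp at this
        omega
      have h3 : t i = Q ⟨i, h2⟩ 0 := dif_pos h2
      rw [h3]
      exact ⟨Fin.is_lt _, h2, _, I.mem_cons_lists s h0, rfl⟩
    · intro d hd
      have e1 := (plurality_eq_iff_okOne I L _ (ht u) _).1 rfl d hd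
      have e2 := (plurality_eq_iff_okOne I L _ (ht v) _).1 rfl d hd
      rw [Function.update_self] at e1 e2
      exact ⟨e1, e2⟩
  · rintro ⟨x, hx, y, hy, U, -, W, -, hpp, t, hT, rfl, rfl, hok⟩
    have : ∀ i : Fin I.n, ∃ w : Vote I.m, i ≠ 0 → w ∈ I.V i :: I.lists i ∧ (w 0 : ℕ) = t i := by
      intro i
      by_cases h0 : i = 0
      · exact ⟨I.V i, fun h => (h h0).elim⟩
      · have h1 : 1 ≤ i.1 := Nat.one_le_iff_ne_zero.2 fun h => h0 (Fin.ext (by simpa using h))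
        obtain ⟨-, _, w, hw⟩ := hT i h1 i.2
        exact ⟨w, fun _ => hw⟩
    choose P hP using this
    obtain ⟨s, hs⟩ := I.exists_outcomeProfile_eq fun i hi => (hP i hi).1
    have ht : ∀ w : Vote I.m, ∀ i : Fin I.n, i ≠ 0 →
        t i = Function.update (I.game.outcomeProfile s) 0 w i 0 := by
      intro w i hi
      rw [Function.update_of_ne hi, hs i hi, (hP i hi).2]
    refine ⟨s, ?_⟩
    rw [(plurality_eq_iff_okOne I L _ (ht u) ⟨x, hx⟩).2 fun d hd => by
        rw [Function.update_self]; exact (hok d hd).1,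
      (plurality_eq_iff_okOne I L _ (ht v) ⟨y, hy⟩).2 fun d hd => by
        rw [Function.update_self]; exact (hok d hd).2]
    exact (hpref ⟨x, hx⟩ ⟨y, hy⟩).1 hpp

end Voting

/-! ### The decision procedures -/

namespace RAM

open Prog Voting

/-- The initial state with the length of the input copied to register `1`. -/
def start (x : List ℕ) : State := (State.init x).setVar 1 x.length

theorem length_le_bitSize (x : List ℕ) : x.length ≤ bitSize x := by
  induction x with
  | nil => simp
  | cons k x ih =>
    simp only [bitSize, List.map_cons, List.sum_cons, List.length_cons] at ih ⊢
    omega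

/-- Register `1` receives the length of the input, which is at most its bit size; the summand `2`
pays for this assignment. -/
theorem polyTimeDecidable_of_prog {α : Type} {enc : α → List ℕ} {P : α → Prop} (p : Prog)
    (hp : p.wf = true) (h1 : 1 ∉ p.writes)
    (h : ∀ a, (P a → (p.den (start (enc a))).var 0 = 1) ∧
      (¬ P a → (p.den (start (enc a))).var 0 = 0)) : PolyTimeDecidable enc P := by
  obtain ⟨C, k, hC⟩ := exists_exec_compile p hp h1
  refine ⟨.seq (.assign 1 (.var 0)) p.compile,
    Polynomial.C C * (Polynomial.X + 1) ^ k + 2, fun a => ?_⟩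
  obtain ⟨t, ht, hle⟩ := hC (start (enc a)) (bitSize (enc a)) (by
    simpa [start, State.setVar] using length_le_bitSize (enc a))
  refine ⟨_, _, .seq (.assign _ _ _) ht, ?_, ?_⟩
  · simp only [Polynomial.eval_add, Polynomial.eval_mul, Polynomial.eval_pow, Polynomial.eval_C,
      Polynomial.eval_X, Polynomial.eval_one, Polynomial.eval_ofNat, Expr.cost]
    omega
  · split_ifs with hP
    · exact (h a).1 hP
    · exact (h a).2 hP

/-- The decision procedures: look for a candidate that satisfies `guard`, which may refer to the
candidate `eV`, such that voting for him weakly dominates voting for the candidate `eT`. -/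
def decider (eT eV guard out : Expr) : Prog :=
  parse ;; .assign rRes (.const 0) ;; .assign rT eT ;; .assign rVote eV ;;
  dominanceLoop guard ;; .assign 0 out

/-- The first candidate of the vote that follows the instance. -/
def topOfVote : Expr := .get 0 (.var rP)

/-- The first candidate of voter 1. -/
def topOfOne : Expr := .get 0 (.var rM + .const 2)

/-- The registers and the input after parsing. -/
structure Parsed (I : Instance) (x tail : List ℕ) (q : State) : Prop where
  env : Env (I.data x.length) q
  input : ∀ i, q.arr 0 i = x.getD i 0
  drop : x.drop (q.var rP) = tail

theorem Parsed.setVar {I : Instance} {x tail : List ℕ} {q : State} (h : Parsed I x tail q)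
    {y : ℕ} (k : ℕ) (hy : 1 ≠ y ∧ rM ≠ y ∧ rN ≠ y ∧ rP ≠ y) :
    Parsed I x tail (q.setVar y k) := by
  obtain ⟨h1, h2, h3, h4⟩ := hy
  refine ⟨h.env.frame ((Frame.refl (.assign y (.const 0)) q).setVar k (by simp [writes])) ?_,
    h.input, by simpa [State.setVar, h4] using h.drop⟩
  simp [writes, stores, h1, h2, h3]

theorem Parsed.eval_topOfVote {I : Instance} {x : List ℕ} {v : Vote I.m} {q : State}
    (h : Parsed I x (encodeVote v) q) : topOfVote.eval q = v 0 := by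
  have := getD_of_drop_encodeVote (h.drop.trans (List.append_nil _).symm) 0
  simpa [topOfVote, eval_get, eval_var, h.input] using this

theorem Parsed.eval_topOfOne {I : Instance} {x tail : List ℕ} {q : State}
    (h : Parsed I x tail q) (hx : x = I.encode ++ tail) : topOfOne.eval q = I.V 0 0 := by
  have h0 : 0 < (List.ofFn I.V).length := by simpa using Nat.pos_of_neZero I.n
  -- The header and the tie-breaking order fill the first `m + 2` cells, and the sincere vote of
  -- voter 1 follows.
  have hd : ∃ t, x.drop (I.m + 2) = encodeVote (I.V 0) ++ t := by
    rw [add_comm, ← List.drop_drop, hx, Instance.encode, ← List.drop_zero (l := List.ofFn I.V),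
      List.drop_eq_getElem_cons h0, List.flatMap_cons, List.getElem_ofFn]
    simp only [List.append_assoc, List.cons_append, List.nil_append, List.drop_succ_cons,
      List.drop_zero, drop_encodeVote_append]
    exact ⟨_, rfl⟩
  obtain ⟨t, ht⟩ := hd
  have := getD_of_drop_encodeVote ht 0
  have hm : q.var rM = I.m := h.env.hm
  simpa [topOfOne, eval_get, eval_add, eval_const, eval_var, h.input, hm] using this

theorem decider_spec (I : Instance) {x tail : List ℕ} (hx : x = I.encode ++ tail)
    {eT eV guard : Expr} (out : Expr) {b : Vote I.m} (w : ℕ) (G : ℕ → Prop)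
    (hT : ∀ q, Parsed I x tail q → eT.eval q = b 0)
    (hV : ∀ q, Parsed I x tail q → eV.eval q = w)
    (hG : ∀ q : State, q.var rVote = w → (guard.eval q ≠ 0 ↔ G (q.var rC))) :
    ∃ r : State, (decider eT eV guard out).den (start x) = (Prog.assign 0 out).den r ∧
      (r.var rRes ≠ 0 ↔ ∃ u : Vote I.m, G (u 0) ∧
        I.game.toNormalForm.WeaklyDominates I.game.playerOne (I.game.strategyOne u)
          (I.game.strategyOne b)) := by
  obtain ⟨henv, hdrop⟩ := parse_spec I hx (s := start x) (by simp [start, State.setVar])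
    (fun i => by simp [start, State.setVar, State.init])
    (fun i => by simp [start, State.setVar, State.init])
  have hP : Parsed I x tail (parse.den (start x)) := ⟨henv, fun i => by
    rw [den_arr _ _ (by decide)]
    simp [start, State.setVar, State.init], hdrop⟩
  rw [decider, den_seq, den_seq, den_seq, den_seq, den_seq]
  generalize parse.den (start x) = q at *
  refine ⟨_, rfl, ?_⟩
  have hP1 : Parsed I x tail ((Prog.assign rRes (.const 0)).den q) := hP.setVar _ (by decide)
  have r1 : ((Prog.assign rRes (.const 0)).den q).var rRes = 0 := by
    simp [den, State.setVar, eval_const]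
  generalize (Prog.assign rRes (.const 0)).den q = q1 at *
  have hP2 : Parsed I x tail ((Prog.assign rT eT).den q1) := hP1.setVar _ (by decide)
  have r2 : ((Prog.assign rT eT).den q1).var rRes = 0 := by simpa [den, State.setVar] using r1
  have t2 : ((Prog.assign rT eT).den q1).var rT = b 0 := by
    simpa [den, State.setVar] using hT q1 hP1
  generalize (Prog.assign rT eT).den q1 = q2 at *
  have hP3 : Parsed I x tail ((Prog.assign rVote eV).den q2) := hP2.setVar _ (by decide)
  have r3 : ((Prog.assign rVote eV).den q2).var rRes = 0 := by simpa [den, State.setVar] using r2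
  have t3 : ((Prog.assign rVote eV).den q2).var rT = b 0 := by simpa [den, State.setVar] using t2
  have v3 : ((Prog.assign rVote eV).den q2).var rVote = w := by
    simpa [den, State.setVar] using hV q2 hP2
  generalize (Prog.assign rVote eV).den q2 = q3 at *
  rw [dominanceLoop_spec hP3.env guard G (fun r hr => hG r (hr.trans v3)), r3, t3]
  simp only [ne_eq, not_true_eq_false, false_or, GSGame.weaklyDominates_iff,
    I.better_iff x.length]
  constructor
  · rintro ⟨c, hc, hGc, hD⟩
    -- Any vote with top `c` will do; this one swaps `c` to the first position.
    refine ⟨Equiv.swap 0 (⟨c, hc⟩ : Fin I.m), ?_⟩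
    rw [Equiv.swap_apply_left]
    exact ⟨hGc, hD⟩
  · rintro ⟨u, hGu, hD⟩
    exact ⟨u 0, Fin.is_lt _, hGu, hD⟩

end RAM

/-! ### Existence of undominated strategies -/

namespace Voting

theorem GSGame.not_weaklyDominates_self {m n : ℕ} [NeZero m] [NeZero n] {tie : Vote m}
    {V : Profile m n} (G : GSGame (plurality tie) V) (v : Vote m) :
    ¬ G.toNormalForm.WeaklyDominates G.playerOne (G.strategyOne v) (G.strategyOne v) := by
  rw [GSGame.weaklyDominates_iff]
  tauto

/-- Weak dominance is a strict order, hence there are undominated strategies. -/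
theorem GSGame.exists_isLevelTwo {m n : ℕ} [NeZero n] {R : VotingRule m n}
    {V : Profile m n} (G : GSGame R V) : ∃ v, G.IsLevelTwo v := by
  let r : Vote m → Vote m → Prop := fun u v => G.Better u v ∧ ¬ G.Better v u
  have htrans : IsTrans (Vote m) r := by
    refine ⟨fun a b c ⟨⟨s, hs⟩, h1⟩ ⟨_, h2⟩ => ?_⟩
    simp only [Better, Prefers, not_exists, not_lt] at hs h1 h2
    refine ⟨⟨s, hs.trans_le (h2 s)⟩, ?_⟩
    rintro ⟨s', hs'⟩
    exact absurd hs' ((h1 s').trans (h2 s')).not_gt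
  have hirr : Std.Irrefl r := ⟨fun a h => h.2 h.1⟩
  obtain ⟨v, -, hv⟩ := (Finite.wellFounded_of_trans_of_irrefl r).has_min Set.univ
    ⟨1, Set.mem_univ _⟩
  refine ⟨v, fun u _ h => hv u (Set.mem_univ _) ?_⟩
  exact (weaklyDominates_iff G u v).1 h

end Voting

/-! ### The four problems -/

namespace RAM

open Prog Voting

theorem den_assign_isNonzero (r : State) :
    ((Prog.assign 0 (.const 1 - (Expr.var rRes).eqE (.const 0))).den r).var 0
      = if r.var rRes ≠ 0 then 1 else 0 := by
  simp only [Prog.den, State.setVar, eval_sub, eval_eqE, eval_var, eval_const,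
    Function.update_self]
  by_cases h : r.var rRes = 0 <;> simp [h]

theorem den_assign_isZero (r : State) :
    ((Prog.assign 0 ((Expr.var rRes).eqE (.const 0))).den r).var 0
      = if r.var rRes ≠ 0 then 0 else 1 := by
  simp only [Prog.den, State.setVar, eval_eqE, eval_var, eval_const, Function.update_self]
  by_cases h : r.var rRes = 0 <;> simp [h]

theorem polyTimeDecidable_isLevelTwo :
    PolyTimeDecidable VoteInstance.encode fun J : VoteInstance => J.game.IsLevelTwo J.vote := by
  refine polyTimeDecidable_of_prog (decider topOfVote (.const 0) (.const 1)
    ((Expr.var rRes).eqE (.const 0))) (by decide) (by decide) fun J => ?_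
  obtain ⟨r, hr, hr'⟩ := decider_spec J.toInstance (x := J.encode) rfl (eT := topOfVote)
    (eV := .const 0) (guard := .const 1) ((Expr.var rRes).eqE (.const 0)) 0 (fun _ => True)
    (fun q hq => hq.eval_topOfVote) (fun q _ => rfl) (fun q _ => by simp [eval_const])
  have hiff : J.game.IsLevelTwo J.vote ↔ ¬ r.var rRes ≠ 0 := by
    rw [hr']
    simp only [true_and, not_exists]
    refine ⟨fun h u hu => ?_, fun h u _ => h u⟩
    -- The loop tries all candidates, including the top of the given vote. This is harmless because
    -- weak dominance is irreflexive.
    by_cases huv : u = J.vote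
    · subst huv
      exact J.game.not_weaklyDominates_self _ hu
    · exact h u huv hu
  rw [hr, den_assign_isZero, hiff]
  exact ⟨fun h => if_neg h, fun h => if_pos (not_not.1 h)⟩

/-- The guard admits only the top of the given vote, so the loop amounts to one comparison with the
sincere favourite. -/
theorem polyTimeDecidable_isImproving :
    PolyTimeDecidable VoteInstance.encode fun J : VoteInstance => J.game.IsImproving J.vote := by
  refine polyTimeDecidable_of_prog (decider topOfOne topOfVote
    ((Expr.var rC).eqE (.var rVote)) (.const 1 - (Expr.var rRes).eqE (.const 0)))
    (by decide) (by decide) fun J => ?_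
  obtain ⟨r, hr, hr'⟩ := decider_spec J.toInstance (x := J.encode) rfl (eT := topOfOne)
    (eV := topOfVote) (guard := (Expr.var rC).eqE (.var rVote))
    (.const 1 - (Expr.var rRes).eqE (.const 0)) (J.vote 0) (fun c => c = J.vote 0)
    (fun q hq => hq.eval_topOfOne rfl) (fun q hq => hq.eval_topOfVote)
    (fun q hq => by simp [eval_eqE, eval_var, hq])
  have hiff : J.game.IsImproving J.vote ↔ r.var rRes ≠ 0 := by
    rw [hr', GSGame.IsImproving]
    refine ⟨fun h => ⟨_, rfl, h⟩, ?_⟩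
    rintro ⟨u, hu, h⟩
    rw [GSGame.weaklyDominates_iff, J.better_iff J.encode.length,
      J.better_iff J.encode.length] at h ⊢
    rwa [hu] at h
  rw [hr, den_assign_isNonzero, hiff]
  exact ⟨fun h => if_pos h, fun h => if_neg h⟩

/-- The answer is always yes, so a constant program suffices. -/
theorem polyTimeDecidable_exists_isLevelTwo :
    PolyTimeDecidable Instance.encode fun I : Instance => ∃ v : Vote I.m, I.game.IsLevelTwo v := by
  refine polyTimeDecidable_of_prog (.assign 0 (.const 1)) rfl (by decide) fun I => ?_
  exact ⟨fun _ => rfl, fun h => (h I.game.exists_isLevelTwo).elim⟩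

theorem polyTimeDecidable_exists_isImproving :
    PolyTimeDecidable Instance.encode fun I : Instance => ∃ v : Vote I.m, I.game.IsImproving v := by
  refine polyTimeDecidable_of_prog (decider topOfOne (.const 0) (.const 1)
    (.const 1 - (Expr.var rRes).eqE (.const 0))) (by decide) (by decide) fun I => ?_
  obtain ⟨r, hr, hr'⟩ := decider_spec I (x := I.encode) (List.append_nil _).symm (eT := topOfOne)
    (eV := .const 0) (guard := .const 1) (.const 1 - (Expr.var rRes).eqE (.const 0)) 0
    (fun _ => True) (fun q hq => hq.eval_topOfOne (List.append_nil _).symm) (fun q _ => rfl)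
    (fun q _ => by simp [eval_const])
  have hiff : (∃ v, I.game.IsImproving v) ↔ r.var rRes ≠ 0 := by
    rw [hr']
    simp only [true_and, GSGame.IsImproving]
  rw [hr, den_assign_isNonzero, hiff]
  exact ⟨fun h => if_pos h, fun h => if_neg h⟩

end RAM

theorem corollary1 :
    RAM.PolyTimeDecidable Voting.VoteInstance.encode
        (fun J : Voting.VoteInstance => J.game.IsLevelTwo J.vote) ∧
      RAM.PolyTimeDecidable Voting.VoteInstance.encode
        (fun J : Voting.VoteInstance => J.game.IsImproving J.vote) ∧
      RAM.PolyTimeDecidable Voting.Instance.encode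
        (fun I : Voting.Instance => ∃ v : Voting.Vote I.m, I.game.IsLevelTwo v) ∧
      RAM.PolyTimeDecidable Voting.Instance.encode
        (fun I : Voting.Instance => ∃ v : Voting.Vote I.m, I.game.IsImproving v) :=
  ⟨RAM.polyTimeDecidable_isLevelTwo, RAM.polyTimeDecidable_isImproving,
    RAM.polyTimeDecidable_exists_isLevelTwo, RAM.polyTimeDecidable_exists_isImproving⟩
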